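/- **Theorem 3.1.** Let $k\in\mathbb N$. For $\lambda\in\mathbb R^k$ put $e_\lambda(x)=e^{i\langle\lambda,x\rangle}$, $x\in\mathbb R^k$, and let $AP^k$ be the closed subalgebra, with respect to the supremum norm, generated by the functions $e_\lambda$ ($\lambda\in\mathbb R^k$) in the algebra of bounded continuous functions $\mathbb R^k\to\mathbb C$. For $f\in AP^k$ let $$f_\lambda=\lim_{T\to\infty}\frac1{(2T)^k}\int_{[-T,T]^k}e^{-i\langle\lambda,x\rangle}f(x)\,dx,\qquad \sigma(f)=\{\lambda\in\mathbb R^k: f_\lambda\ne0\}$$ be its Bohr–Fourier coefficients and its Bohr–Fourier spectrum, and let $APW^k=\{f\in AP^k:\sum_{\lambda}|f_\lambda|<\infty\}$, which is a Banach algebra with the norm $\|f\|_W=\sum_\lambda|f_\lambda|$. A set $S\subseteq\mathbb R^k$ is a *halfspace* if $\mathbb R^k=S\cup(-S)$, $S\cap(-S)=\{0\}$, $\lambda+\mu\in S$ for all $\lambda,\mu\in S$, and $\alpha\lambda\in S$ for all $\lambda\in S$ and all real $\alpha\ge0$. Let $S\subset\mathbb R^k$ be a halfspace and let $\Sigma\subseteq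 S$ be an additive semigroup (that is, $\lambda+\mu\in\Sigma$ for all $\lambda,\mu\in\Sigma$) containing $0$. Consider the commutative unital Banach algebras $$AP^k_\Sigma=\{f\in AP^k:\sigma(f)\subseteq\Sigma\},\qquad APW^k_\Sigma=\{f\in APW^k:\sigma(f)\subseteq\Sigma\},$$ with the norms $\|\cdot\|_\infty$ and $\|\cdot\|_W$ respectively. Then the maximal ideal spaces $\mathbb M(AP^k_\Sigma)$ and $\mathbb M(APW^k_\Sigma)$ are contractible. Here the maximal ideal space $\mathbb M(\mathcal A)$ of a commutative unital Banach algebra $\mathcal A$ is the set of all nonzero multiplicative linear functionals $\phi:\mathcal A\to\mathbb C$ (these are automatically bounded), with the topology induced by the weak$^*$ topology of the dual space $\mathcal A^*$. -/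

import Mathlib

open Filter Topology MeasureTheory
open scoped BoundedContinuousFunction Pointwise

noncomputable section

namespace AlmostPeriodic

variable {k : ℕ}

/-- A halfspace of `ℝ^k`: the nonnegative cone of a total vector order. -/
structure IsHalfspace (S : Set (Fin k → ℝ)) : Prop where
  union_neg : S ∪ -S = Set.univ
  inter_neg : S ∩ -S = {0}
  add_mem : ∀ l ∈ S, ∀ m ∈ S, l + m ∈ S
  smul_mem : ∀ l ∈ S, ∀ a : ℝ, 0 ≤ a → a • l ∈ S

/-- The elementary exponential `x ↦ exp (i ⟨l, x⟩)`. -/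
def expo (l : Fin k → ℝ) : (Fin k → ℝ) →ᵇ ℂ :=
  BoundedContinuousFunction.ofNormedAddCommGroup
    (fun x => Complex.exp (Complex.I * ((l ⬝ᵥ x : ℝ) : ℂ)))
    (by unfold dotProduct; fun_prop) 1
    (fun x => by rw [mul_comm, Complex.norm_exp_ofReal_mul_I])

/-- The algebra `AP^k` of almost periodic functions on `ℝ^k`: the closed subalgebra, for the
supremum norm, generated by the elementary exponentials. -/
def AP (k : ℕ) : Subalgebra ℂ ((Fin k → ℝ) →ᵇ ℂ) :=
  (Algebra.adjoin ℂ (Set.range (expo (k := k)))).topologicalClosure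

/-- The average of `f` over the cube `[-T, T]^k`. -/
def cubeAvg (f : (Fin k → ℝ) → ℂ) (T : ℝ) : ℂ :=
  ((1 / (2 * T) ^ k : ℝ) : ℂ) *
    ∫ x in Set.Icc (fun _ : Fin k => -T) (fun _ : Fin k => T), f x

/-- The Bohr mean: the limit of the averages over the cubes `[-T, T]^k` as `T → ∞`.
The limit exists for every almost periodic function, see `tendsto_cubeAvg`. -/
def bohrMean (f : (Fin k → ℝ) → ℂ) : ℂ := limUnder atTop (cubeAvg f)

/-- The Bohr-Fourier coefficient `f_l`. -/
def bohrCoeff (f : (Fin k → ℝ) → ℂ) (l : Fin k → ℝ) : ℂ :=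
  bohrMean fun x => Complex.exp (-(Complex.I * ((l ⬝ᵥ x : ℝ) : ℂ))) * f x

/-- The Bohr-Fourier spectrum `σ(f)`. -/
def bohrSpectrum (f : (Fin k → ℝ) → ℂ) : Set (Fin k → ℝ) := {l | bohrCoeff f l ≠ 0}

/-! Facts needed to see that prescribing the spectrum cuts out subalgebras. -/

lemma expo_apply (l x : Fin k → ℝ) :
    expo l x = Complex.exp (Complex.I * ((l ⬝ᵥ x : ℝ) : ℂ)) := rfl

lemma expo_zero : expo (0 : Fin k → ℝ) = 1 := by
  ext x; simp [expo_apply]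

lemma expo_add (l m : Fin k → ℝ) : expo (l + m) = expo l * expo m := by
  ext x
  simp [expo_apply, add_dotProduct, mul_add, Complex.exp_add]

lemma star_expo (l : Fin k → ℝ) : star (expo l) = expo (-l) := by
  ext x
  simp [expo_apply, ← Complex.exp_conj]

lemma expo_mem (l : Fin k → ℝ) : expo l ∈ AP k :=
  Subalgebra.le_topologicalClosure _ (Algebra.subset_adjoin ⟨l, rfl⟩)

lemma adjoin_eq_span : Subalgebra.toSubmodule (Algebra.adjoin ℂ (Set.range (expo (k := k))))
    = Submodule.span ℂ (Set.range (expo (k := k))) := by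
  have h : (Submonoid.closure (Set.range (expo (k := k))) : Set _)
      = Set.range (expo (k := k)) := by
    apply Set.Subset.antisymm _ Submonoid.subset_closure
    let N : Submonoid ((Fin k → ℝ) →ᵇ ℂ) :=
      { carrier := Set.range (expo (k := k))
        one_mem' := ⟨0, expo_zero⟩
        mul_mem' := by
          rintro _ _ ⟨l, rfl⟩ ⟨m, rfl⟩
          exact ⟨l + m, expo_add l m⟩ }
    exact (Submonoid.closure_le (S := N)).2 subset_rfl
  rw [Algebra.adjoin_eq_span, h]

lemma mem_AP_iff {f : (Fin k → ℝ) →ᵇ ℂ} :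
    f ∈ AP k ↔ f ∈ closure (Submodule.span ℂ (Set.range (expo (k := k))) : Set _) := by
  rw [← adjoin_eq_span]; rfl

lemma star_mem {f : (Fin k → ℝ) →ᵇ ℂ} (hf : f ∈ AP k) : star f ∈ AP k := by
  rw [mem_AP_iff] at hf ⊢
  refine map_mem_closure (continuous_star) hf ?_
  intro p hp
  induction hp using Submodule.span_induction with
  | mem x hx =>
    obtain ⟨l, rfl⟩ := hx
    rw [star_expo]; exact Submodule.subset_span ⟨_, rfl⟩
  | zero => simp
  | add x y _ _ hx hy => rw [star_add]; exact Submodule.add_mem _ hx hy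
  | smul c x _ hx => rw [star_smul]; exact Submodule.smul_mem _ _ hx

lemma volume_cube {T : ℝ} (hT : 0 < T) :
    volume.real (Set.Icc (fun _ : Fin k => -T) (fun _ : Fin k => T)) = (2 * T) ^ k := by
  rw [Measure.real, Real.volume_Icc_pi_toReal (fun _ => by linarith)]
  simp; ring_nf

lemma norm_cubeAvg_le {f : (Fin k → ℝ) → ℂ} {C T : ℝ} (hT : 0 < T) (hf : ∀ x, ‖f x‖ ≤ C) :
    ‖cubeAvg f T‖ ≤ C := by
  have h := norm_setIntegral_le_of_norm_le_const (μ := volume)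
    (s := Set.Icc (fun _ : Fin k => -T) (fun _ : Fin k => T)) (f := f) (C := C)
    isCompact_Icc.measure_lt_top (fun x _ => hf x)
  rw [volume_cube hT] at h
  have hp : 0 < (2 * T) ^ k := by positivity
  rw [cubeAvg, norm_mul, Complex.norm_real, Real.norm_of_nonneg (by positivity),
    one_div, inv_mul_le_iff₀ hp]
  linarith

lemma integrableOn_cube (f : (Fin k → ℝ) →ᵇ ℂ) (T : ℝ) :
    IntegrableOn f (Set.Icc (fun _ : Fin k => -T) (fun _ : Fin k => T)) :=
  f.continuous.integrableOn_Icc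

lemma cubeAvg_add (f g : (Fin k → ℝ) →ᵇ ℂ) (T : ℝ) :
    cubeAvg (f + g : (Fin k → ℝ) →ᵇ ℂ) T = cubeAvg f T + cubeAvg g T := by
  simp only [cubeAvg, BoundedContinuousFunction.coe_add, Pi.add_apply]
  rw [integral_add (integrableOn_cube f T) (integrableOn_cube g T), mul_add]

lemma cubeAvg_smul (c : ℂ) (f : (Fin k → ℝ) →ᵇ ℂ) (T : ℝ) :
    cubeAvg (c • f : (Fin k → ℝ) →ᵇ ℂ) T = c * cubeAvg f T := by
  simp only [cubeAvg, BoundedContinuousFunction.coe_smul, smul_eq_mul]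
  rw [integral_const_mul]; ring

lemma cubeAvg_sub (f g : (Fin k → ℝ) →ᵇ ℂ) (T : ℝ) :
    cubeAvg (f - g : (Fin k → ℝ) →ᵇ ℂ) T = cubeAvg f T - cubeAvg g T := by
  have := cubeAvg_add f ((-1 : ℂ) • g) T
  rw [cubeAvg_smul] at this
  rw [show f - g = f + (-1 : ℂ) • g by rw [neg_one_smul, sub_eq_add_neg], this]; ring

lemma tendsto_avg_exp (a : ℝ) :
    Tendsto (fun T : ℝ => ((1 / (2 * T) : ℝ) : ℂ) *
      ∫ x in Set.Icc (-T) T, Complex.exp (Complex.I * ((a * x : ℝ) : ℂ))) atTop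
      (𝓝 (if a = 0 then 1 else 0)) := by
  split_ifs with h
  · subst h
    refine tendsto_const_nhds.congr' ?_
    filter_upwards [eventually_gt_atTop 0] with T hT
    have : (T : ℂ) ≠ 0 := by exact_mod_cast hT.ne'
    simp [hT.le]
    field_simp
    norm_num
  · rw [tendsto_zero_iff_norm_tendsto_zero]
    have hlim : Tendsto (fun T : ℝ => |a|⁻¹ * T⁻¹) atTop (𝓝 0) := by
      simpa using tendsto_inv_atTop_zero.const_mul (|a|⁻¹)
    refine squeeze_zero' (Eventually.of_forall fun _ => norm_nonneg _) ?_ hlim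
    filter_upwards [eventually_gt_atTop 0] with T hT
    have hc : Complex.I * a ≠ 0 := by simp [h]
    have hI : ∫ x in Set.Icc (-T) T, Complex.exp (Complex.I * ((a * x : ℝ) : ℂ))
        = (Complex.exp (Complex.I * a * T) - Complex.exp (Complex.I * a * (-T : ℝ)))
          / (Complex.I * a) := by
      rw [integral_Icc_eq_integral_Ioc, ← intervalIntegral.integral_of_le (by linarith),
        ← integral_exp_mul_complex hc]
      congr 1; ext x; push_cast; ring_nf
    have h1 : ∀ y : ℝ, ‖Complex.exp (Complex.I * a * y)‖ = 1 := fun y => by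
      rw [show Complex.I * a * y = ((a * y : ℝ) : ℂ) * Complex.I by push_cast; ring,
        Complex.norm_exp_ofReal_mul_I]
    rw [hI, norm_mul, norm_div, Complex.norm_real, norm_mul, Complex.norm_I, one_mul,
      Complex.norm_real, Real.norm_of_nonneg (by positivity), Real.norm_eq_abs]
    have h2 : ‖Complex.exp (Complex.I * a * T) - Complex.exp (Complex.I * a * (-T : ℝ))‖ ≤ 2 := by
      refine (norm_sub_le _ _).trans ?_
      rw [h1, h1]; norm_num
    have ha : 0 < |a| := abs_pos.2 h
    calc 1 / (2 * T) * (_ / |a|) ≤ 1 / (2 * T) * (2 / |a|) := by gcongr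
      _ = |a|⁻¹ * T⁻¹ := by field_simp

lemma tendsto_cubeAvg_expo (l : Fin k → ℝ) :
    Tendsto (cubeAvg (expo l)) atTop (𝓝 (if l = 0 then 1 else 0)) := by
  have h := tendsto_finsetProd (Finset.univ : Finset (Fin k))
    (fun i _ => tendsto_avg_exp (l i))
  have h2 : (∏ i : Fin k, (if l i = 0 then (1 : ℂ) else 0)) = if l = 0 then 1 else 0 := by
    split_ifs with hl
    · subst hl; simp
    · obtain ⟨i, hi⟩ : ∃ i, l i ≠ 0 := by
        by_contra! hc; exact hl (funext hc)
      exact Finset.prod_eq_zero (Finset.mem_univ i) (by simp [hi])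
  rw [h2] at h
  refine h.congr fun T => ?_
  rw [Finset.prod_mul_distrib, cubeAvg]
  congr 1
  · simp [mul_pow, mul_comm]
  · rw [← Set.pi_univ_Icc, volume_pi, Measure.restrict_pi_pi, ← integral_fintype_prod_eq_prod]
    congr 1; ext x
    rw [expo_apply, ← Complex.exp_sum, ← Finset.mul_sum]
    simp [dotProduct]

lemma exists_tendsto_cubeAvg {f : (Fin k → ℝ) →ᵇ ℂ} (hf : f ∈ AP k) :
    ∃ m, Tendsto (cubeAvg f) atTop (𝓝 m) := by
  have hspan : ∀ p ∈ Submodule.span ℂ (Set.range (expo (k := k))),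
      ∃ m, Tendsto (cubeAvg p) atTop (𝓝 m) := by
    intro p hp
    induction hp using Submodule.span_induction with
    | mem x hx => obtain ⟨l, rfl⟩ := hx; exact ⟨_, tendsto_cubeAvg_expo l⟩
    | zero =>
      refine ⟨0, ?_⟩
      have : cubeAvg (0 : (Fin k → ℝ) →ᵇ ℂ) = fun _ => (0 : ℂ) := by
        ext T; simp [cubeAvg]
      rw [this]; exact tendsto_const_nhds
    | add x y _ _ hx hy =>
      obtain ⟨a, ha⟩ := hx
      obtain ⟨b, hb⟩ := hy
      exact ⟨a + b, (ha.add hb).congr fun T => (cubeAvg_add x y T).symm⟩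
    | smul c x _ hx =>
      obtain ⟨a, ha⟩ := hx
      exact ⟨c * a, (ha.const_mul c).congr fun T => (cubeAvg_smul c x T).symm⟩
  rw [mem_AP_iff, Metric.mem_closure_iff] at hf
  apply cauchy_map_iff_exists_tendsto.1
  rw [Metric.cauchy_iff]
  refine ⟨inferInstance, fun ε hε => ?_⟩
  obtain ⟨p, hp, hfp⟩ := hf (ε / 4) (by linarith)
  obtain ⟨m, hm⟩ := hspan p hp
  refine ⟨Metric.ball m (ε / 2), ?_, ?_⟩
  · rw [Filter.mem_map]
    filter_upwards [hm (Metric.ball_mem_nhds m (show 0 < ε / 4 by linarith)),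
      eventually_gt_atTop (0 : ℝ)] with T hT hT0
    have h1 : ‖cubeAvg (f - p : (Fin k → ℝ) →ᵇ ℂ) T‖ ≤ ‖f - p‖ :=
      norm_cubeAvg_le hT0 (fun x => (f - p).norm_coe_le_norm x)
    rw [cubeAvg_sub] at h1
    rw [dist_eq_norm] at hfp
    have h3 : dist (cubeAvg p T) m < ε / 4 := hT
    have h4 := dist_triangle (cubeAvg f T) (cubeAvg p T) m
    rw [dist_eq_norm (cubeAvg f T)  (cubeAvg p T)] at h4
    change dist _ _ < _
    linarith
  · intro x hx y hy
    have := dist_triangle_right x y m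
    rw [Metric.mem_ball] at hx hy
    linarith

/-- The limit in the definition of the Bohr mean exists for almost periodic functions. -/
lemma tendsto_cubeAvg {f : (Fin k → ℝ) →ᵇ ℂ} (hf : f ∈ AP k) :
    Tendsto (cubeAvg f) atTop (𝓝 (bohrMean f)) :=
  tendsto_nhds_limUnder (exists_tendsto_cubeAvg hf)

lemma bohrMean_add {f g : (Fin k → ℝ) →ᵇ ℂ} (hf : f ∈ AP k) (hg : g ∈ AP k) :
    bohrMean (f + g : (Fin k → ℝ) →ᵇ ℂ) = bohrMean f + bohrMean g :=
  tendsto_nhds_unique (tendsto_cubeAvg (add_mem hf hg))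
    (((tendsto_cubeAvg hf).add (tendsto_cubeAvg hg)).congr fun T => (cubeAvg_add f g T).symm)

lemma bohrMean_sub {f g : (Fin k → ℝ) →ᵇ ℂ} (hf : f ∈ AP k) (hg : g ∈ AP k) :
    bohrMean (f - g : (Fin k → ℝ) →ᵇ ℂ) = bohrMean f - bohrMean g :=
  tendsto_nhds_unique (tendsto_cubeAvg (sub_mem hf hg))
    (((tendsto_cubeAvg hf).sub (tendsto_cubeAvg hg)).congr fun T => (cubeAvg_sub f g T).symm)

lemma bohrMean_smul (c : ℂ) {f : (Fin k → ℝ) →ᵇ ℂ} (hf : f ∈ AP k) :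
    bohrMean (c • f : (Fin k → ℝ) →ᵇ ℂ) = c * bohrMean f :=
  tendsto_nhds_unique (tendsto_cubeAvg ((AP k).smul_mem hf c))
    (((tendsto_cubeAvg hf).const_mul c).congr fun T => (cubeAvg_smul c f T).symm)

lemma bohrMean_expo (l : Fin k → ℝ) : bohrMean (expo l) = if l = 0 then 1 else 0 :=
  tendsto_nhds_unique (tendsto_cubeAvg (expo_mem l)) (tendsto_cubeAvg_expo l)

lemma bohrMean_sum {ι : Type*} (F : Finset ι) (f : ι → (Fin k → ℝ) →ᵇ ℂ)
    (hf : ∀ i, f i ∈ AP k) :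
    bohrMean (∑ i ∈ F, f i : (Fin k → ℝ) →ᵇ ℂ) = ∑ i ∈ F, bohrMean (f i) := by
  classical
  induction F using Finset.induction_on with
  | empty => simpa using bohrMean_smul 0 (zero_mem (AP k))
  | insert a F ha ih =>
    rw [Finset.sum_insert ha, Finset.sum_insert ha,
      bohrMean_add (hf a) (sum_mem fun i _ => hf i), ih]

lemma norm_bohrMean_le {f : (Fin k → ℝ) →ᵇ ℂ} (hf : f ∈ AP k) : ‖bohrMean f‖ ≤ ‖f‖ :=
  le_of_tendsto (tendsto_cubeAvg hf).norm <| by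
    filter_upwards [eventually_gt_atTop 0] with T hT
    exact norm_cubeAvg_le hT f.norm_coe_le_norm

lemma bohrMean_star {f : (Fin k → ℝ) →ᵇ ℂ} (hf : f ∈ AP k) :
    bohrMean (star f : (Fin k → ℝ) →ᵇ ℂ) = star (bohrMean f) := by
  refine tendsto_nhds_unique (tendsto_cubeAvg (star_mem hf))
    ((tendsto_cubeAvg hf).star.congr fun T => ?_)
  simp only [cubeAvg, BoundedContinuousFunction.coe_star, Pi.star_apply, RCLike.star_def,
    map_mul, Complex.conj_ofReal, integral_conj]

lemma bohrCoeff_eq (f : (Fin k → ℝ) →ᵇ ℂ) (l : Fin k → ℝ) :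
    bohrCoeff f l = bohrMean (expo (-l) * f : (Fin k → ℝ) →ᵇ ℂ) := by
  unfold bohrCoeff
  congr 1; ext x
  simp [expo_apply]

lemma bohrCoeff_expo (l m : Fin k → ℝ) :
    bohrCoeff (expo l) m = if l = m then 1 else 0 := by
  rw [bohrCoeff_eq, ← expo_add, bohrMean_expo]
  simp only [neg_add_eq_zero, eq_comm]

lemma bohrCoeff_add {f g : (Fin k → ℝ) →ᵇ ℂ} (hf : f ∈ AP k) (hg : g ∈ AP k)
    (l : Fin k → ℝ) :
    bohrCoeff (f + g : (Fin k → ℝ) →ᵇ ℂ) l = bohrCoeff f l + bohrCoeff g l := by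
  simp only [bohrCoeff_eq]
  rw [mul_add, bohrMean_add (mul_mem (expo_mem _) hf) (mul_mem (expo_mem _) hg)]

lemma bohrCoeff_smul (c : ℂ) {f : (Fin k → ℝ) →ᵇ ℂ} (hf : f ∈ AP k) (l : Fin k → ℝ) :
    bohrCoeff (c • f : (Fin k → ℝ) →ᵇ ℂ) l = c * bohrCoeff f l := by
  simp only [bohrCoeff_eq]
  rw [mul_smul_comm, bohrMean_smul c (mul_mem (expo_mem _) hf)]

/-- The distance, in quadratic mean, from `u` to a trigonometric polynomial. -/
lemma bohrMean_star_sub_mul_sub {u : (Fin k → ℝ) →ᵇ ℂ} (hu : u ∈ AP k)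
    (F : Finset (Fin k → ℝ)) (c : (Fin k → ℝ) → ℂ) :
    (bohrMean (star (u - ∑ m ∈ F, c m • expo m) * (u - ∑ m ∈ F, c m • expo m) :
      (Fin k → ℝ) →ᵇ ℂ)).re
    = (bohrMean (star u * u : (Fin k → ℝ) →ᵇ ℂ)).re - ∑ m ∈ F, ‖bohrCoeff u m‖ ^ 2
      + ∑ m ∈ F, ‖bohrCoeff u m - c m‖ ^ 2 := by
  classical
  set p := ∑ m ∈ F, c m • expo m with hp
  have hpm : p ∈ AP k := sum_mem fun m _ => (AP k).smul_mem (expo_mem m) _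
  have hps : ∀ g ∈ AP k, bohrMean (star p * g : (Fin k → ℝ) →ᵇ ℂ)
      = ∑ m ∈ F, star (c m) * bohrCoeff g m := by
    intro g hg
    have : star p * g = ∑ m ∈ F, star (c m) • (expo (-m) * g) := by
      rw [hp, star_sum, Finset.sum_mul]
      refine Finset.sum_congr rfl fun m _ => ?_
      rw [star_smul, star_expo, smul_mul_assoc]
    rw [this, bohrMean_sum _ _ fun m => (AP k).smul_mem (mul_mem (expo_mem _) hg) _]
    refine Finset.sum_congr rfl fun m _ => ?_
    rw [bohrMean_smul _ (mul_mem (expo_mem _) hg), bohrCoeff_eq]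
  have hpc : ∀ m ∈ F, bohrCoeff p m = c m := by
    intro m hm
    rw [bohrCoeff_eq, hp, Finset.mul_sum,
      bohrMean_sum _ _ fun m => mul_mem (expo_mem _) ((AP k).smul_mem (expo_mem _) _)]
    have : ∀ n ∈ F, bohrMean (expo (-m) * c n • expo n : (Fin k → ℝ) →ᵇ ℂ)
        = if n = m then c n else 0 := by
      intro n _
      rw [mul_smul_comm, bohrMean_smul _ (mul_mem (expo_mem _) (expo_mem _)),
        ← bohrCoeff_eq, bohrCoeff_expo]
      simp
    rw [Finset.sum_congr rfl this]
    simp [hm]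
  have e1 : star (u - p) * (u - p) = star u * u - star p * u - star (star p * u) + star p * p := by
    rw [star_sub, star_mul, star_star]; ring
  have su := star_mem hu
  have sp := star_mem hpm
  have hpp : ∑ m ∈ F, star (c m) * bohrCoeff p m = ∑ m ∈ F, star (c m) * c m :=
    Finset.sum_congr rfl fun m hm => by rw [hpc m hm]
  have m1 := mul_mem su hu
  have m2 := mul_mem sp hu
  have m3 := star_mem m2
  rw [e1, bohrMean_add (sub_mem (sub_mem m1 m2) m3) (mul_mem sp hpm),
    bohrMean_sub (sub_mem m1 m2) m3, bohrMean_sub m1 m2, bohrMean_star m2, hps u hu, hps p hpm,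
    hpp]
  simp only [Complex.add_re, Complex.sub_re, RCLike.star_def, Complex.conj_re, Complex.re_sum]
  rw [sub_sub, sub_add, sub_add, sub_right_inj, ← Finset.sum_add_distrib,
    ← Finset.sum_sub_distrib, ← Finset.sum_sub_distrib]
  refine Finset.sum_congr rfl fun m _ => ?_
  rw [← Complex.normSq_eq_norm_sq, ← Complex.normSq_eq_norm_sq]
  simp only [Complex.normSq_apply, Complex.mul_re, Complex.conj_re, Complex.conj_im,
    Complex.sub_re, Complex.sub_im]
  ring

lemma norm_bohrMean_mul_le {w v : (Fin k → ℝ) →ᵇ ℂ} (hw : w ∈ AP k) (hv : v ∈ AP k) {ε : ℝ}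
    (hε : 0 < ε) (h : (bohrMean (star w * w : (Fin k → ℝ) →ᵇ ℂ)).re ≤ ε ^ 2) :
    ‖bohrMean (w * v : (Fin k → ℝ) →ᵇ ℂ)‖ ≤ ‖v‖ * ε := by
  have hww := mul_mem (star_mem hw) hw
  have hlim : Tendsto (fun T => ‖v‖ * (ε / 2 +
      (cubeAvg (star w * w : (Fin k → ℝ) →ᵇ ℂ) T).re / (2 * ε))) atTop
      (𝓝 (‖v‖ * (ε / 2 + (bohrMean (star w * w : (Fin k → ℝ) →ᵇ ℂ)).re / (2 * ε)))) :=
    ((((Complex.continuous_re.tendsto _).comp (tendsto_cubeAvg hww)).div_const _).const_add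
      _).const_mul _
  have hle : ‖bohrMean (w * v : (Fin k → ℝ) →ᵇ ℂ)‖
      ≤ ‖v‖ * (ε / 2 + (bohrMean (star w * w : (Fin k → ℝ) →ᵇ ℂ)).re / (2 * ε)) := by
    refine le_of_tendsto_of_tendsto (tendsto_cubeAvg (mul_mem hw hv)).norm hlim ?_
    filter_upwards [eventually_gt_atTop 0] with T hT
    set Q := Set.Icc (fun _ : Fin k => -T) (fun _ : Fin k => T) with hQ
    have hp : 0 < (2 * T) ^ k := by positivity
    have hre : (cubeAvg (star w * w : (Fin k → ℝ) →ᵇ ℂ) T).re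
        = 1 / (2 * T) ^ k * ∫ x in Q, ‖w x‖ ^ 2 := by
      rw [cubeAvg, Complex.re_ofReal_mul]
      congr 1
      have : ∀ x, (star w * w : (Fin k → ℝ) →ᵇ ℂ) x = ((‖w x‖ ^ 2 : ℝ) : ℂ) := fun x => by
        simp [Complex.conj_mul']
      simp_rw [this]
      rw [integral_complex_ofReal, Complex.ofReal_re]
    have hi : IntegrableOn (fun x => ‖w x‖ ^ 2) Q :=
      (w.continuous.norm.pow 2).integrableOn_Icc
    have hc : IntegrableOn (fun _ : Fin k → ℝ => ε / 2) Q := continuous_const.integrableOn_Icc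
    have hpt : ‖∫ x in Q, (w * v : (Fin k → ℝ) →ᵇ ℂ) x‖
        ≤ ∫ x in Q, ‖v‖ * (ε / 2 + ‖w x‖ ^ 2 / (2 * ε)) := by
      refine norm_integral_le_of_norm_le ((hc.add (hi.div_const _)).const_mul _)
        (Eventually.of_forall fun x => ?_)
      have h1 := v.norm_coe_le_norm x
      have h2 : ‖w x‖ ≤ ε / 2 + ‖w x‖ ^ 2 / (2 * ε) := by
        have h3 : ε / 2 + ‖w x‖ ^ 2 / (2 * ε) - ‖w x‖ = (ε - ‖w x‖) ^ 2 / (2 * ε) := by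
          field_simp; ring
        have h4 : 0 ≤ (ε - ‖w x‖) ^ 2 / (2 * ε) := by positivity
        linarith
      rw [BoundedContinuousFunction.coe_mul, Pi.mul_apply, norm_mul, mul_comm]
      exact mul_le_mul h1 h2 (norm_nonneg _) (norm_nonneg _)
    rw [integral_const_mul, integral_add hc (hi.div_const (2 * ε)),
      integral_div (2 * ε) (fun x => ‖w x‖ ^ 2),
      setIntegral_const, volume_cube hT, smul_eq_mul] at hpt
    rw [hre, cubeAvg, norm_mul, Complex.norm_real, Real.norm_of_nonneg (by positivity)]
    calc _ ≤ 1 / (2 * T) ^ k * _ := mul_le_mul_of_nonneg_left hpt (by positivity)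
      _ = _ := by field_simp
  refine hle.trans (mul_le_mul_of_nonneg_left ?_ (norm_nonneg _))
  have : (bohrMean (star w * w : (Fin k → ℝ) →ᵇ ℂ)).re / (2 * ε) ≤ ε ^ 2 / (2 * ε) := by gcongr
  have h5 : ε ^ 2 / (2 * ε) = ε / 2 := by field_simp
  linarith

/-- Parseval's formula. -/
lemma hasSum_bohrMean_mul {u v : (Fin k → ℝ) →ᵇ ℂ} (hu : u ∈ AP k) (hv : v ∈ AP k) :
    HasSum (fun m => bohrCoeff u m * bohrCoeff v (-m))
      (bohrMean (u * v : (Fin k → ℝ) →ᵇ ℂ)) := by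
  classical
  rw [HasSum, SummationFilter.unconditional_filter, Metric.tendsto_atTop]
  intro ε hε
  set δ := ε / (‖v‖ + 1) with hδ
  have hv0 := norm_nonneg v
  have hδ0 : 0 < δ := by positivity
  obtain ⟨p, hp, hup⟩ := Metric.mem_closure_iff.1 (mem_AP_iff.1 hu) δ hδ0
  obtain ⟨c, rfl⟩ := Finsupp.mem_span_range_iff_exists_finsupp.1 hp
  refine ⟨c.support, fun F hF => ?_⟩
  have hcF : (c.sum fun i a => a • expo i) = ∑ m ∈ F, c m • expo m :=
    Finset.sum_subset hF fun m _ hm => by simp [Finsupp.notMem_support_iff.1 hm]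
  rw [hcF, dist_eq_norm] at hup
  set w := u - ∑ m ∈ F, bohrCoeff u m • expo m with hw
  have hsm : ∀ a : (Fin k → ℝ) → ℂ, ∑ m ∈ F, a m • expo m ∈ AP k := fun a =>
    sum_mem fun m _ => (AP k).smul_mem (expo_mem m) _
  have hwm : w ∈ AP k := sub_mem hu (hsm _)
  have hw2 : (bohrMean (star w * w : (Fin k → ℝ) →ᵇ ℂ)).re ≤ δ ^ 2 := by
    have h1 := bohrMean_star_sub_mul_sub hu F (fun m => bohrCoeff u m)
    have h2 := bohrMean_star_sub_mul_sub hu F c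
    have h3 : 0 ≤ ∑ m ∈ F, ‖bohrCoeff u m - c m‖ ^ 2 := Finset.sum_nonneg fun _ _ => by positivity
    set q := u - ∑ m ∈ F, c m • expo m with hq
    have hqm : q ∈ AP k := sub_mem hu (hsm _)
    have h4 : (bohrMean (star q * q : (Fin k → ℝ) →ᵇ ℂ)).re ≤ ‖q‖ ^ 2 := by
      refine (Complex.re_le_norm _).trans ((norm_bohrMean_le (mul_mem (star_mem hqm) hqm)).trans ?_)
      refine (norm_mul_le _ _).trans ?_
      rw [norm_star, sq]
    have h5 : ‖q‖ ^ 2 ≤ δ ^ 2 := by gcongr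
    rw [← hw] at h1
    simp only [sub_self, norm_zero] at h1
    simp only [ne_eq, OfNat.ofNat_ne_zero, not_false_eq_true, zero_pow, Finset.sum_const_zero,
      add_zero] at h1
    linarith
  have hmean : bohrMean (w * v : (Fin k → ℝ) →ᵇ ℂ) = bohrMean (u * v : (Fin k → ℝ) →ᵇ ℂ)
      - ∑ m ∈ F, bohrCoeff u m * bohrCoeff v (-m) := by
    rw [hw, sub_mul, bohrMean_sub (mul_mem hu hv) (mul_mem (hsm _) hv), Finset.sum_mul,
      bohrMean_sum _ _ fun m => mul_mem ((AP k).smul_mem (expo_mem m) _) hv]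
    congr 1
    refine Finset.sum_congr rfl fun m _ => ?_
    rw [smul_mul_assoc, bohrMean_smul _ (mul_mem (expo_mem _) hv), bohrCoeff_eq v, neg_neg]
  have hfin := norm_bohrMean_mul_le hwm hv hδ0 hw2
  rw [hmean] at hfin
  rw [dist_comm, dist_eq_norm]
  refine hfin.trans_lt ?_
  rw [hδ, mul_div_assoc', div_lt_iff₀ (by positivity)]
  nlinarith

/-- The coefficients of a product are the convolution of the coefficients. -/
lemma hasSum_bohrCoeff_mul {f g : (Fin k → ℝ) →ᵇ ℂ} (hf : f ∈ AP k) (hg : g ∈ AP k)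
    (l : Fin k → ℝ) :
    HasSum (fun m => bohrCoeff f m * bohrCoeff g (l - m))
      (bohrCoeff (f * g : (Fin k → ℝ) →ᵇ ℂ) l) := by
  have h := hasSum_bohrMean_mul hf (mul_mem (expo_mem (-l)) hg)
  rw [mul_left_comm, ← bohrCoeff_eq] at h
  convert h using 3 with m
  rw [bohrCoeff_eq g, bohrCoeff_eq, ← mul_assoc, ← expo_add]
  congr 4
  abel

/-- `AP^k_Σ`: the almost periodic functions with Bohr-Fourier spectrum in the additive
semigroup with zero `Σ`. -/
def APOn (Sig : AddSubmonoid (Fin k → ℝ)) : Subalgebra ℂ ((Fin k → ℝ) →ᵇ ℂ) where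
  carrier := {f | f ∈ AP k ∧ bohrSpectrum f ⊆ Sig}
  mul_mem' := by
    rintro f g ⟨hf, hfs⟩ ⟨hg, hgs⟩
    refine ⟨mul_mem hf hg, fun l hl => ?_⟩
    by_contra hlS
    refine hl ((hasSum_bohrCoeff_mul hf hg l).unique ?_)
    convert hasSum_zero with m
    by_contra hne
    have h1 : m ∈ Sig := hfs (left_ne_zero_of_mul hne)
    have h2 : l - m ∈ Sig := hgs (right_ne_zero_of_mul hne)
    exact hlS (by simpa using add_mem h1 h2)
  add_mem' := by
    rintro f g ⟨hf, hfs⟩ ⟨hg, hgs⟩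
    refine ⟨add_mem hf hg, fun l hl => ?_⟩
    by_contra hlS
    refine hl ?_
    rw [bohrCoeff_add hf hg, not_not.1 fun h => hlS (hfs h), not_not.1 fun h => hlS (hgs h),
      add_zero]
  algebraMap_mem' := by
    intro c
    refine ⟨(AP k).algebraMap_mem c, fun l hl => ?_⟩
    by_contra hlS
    refine hl ?_
    have h0 : (0 : Fin k → ℝ) ≠ l := fun h => hlS (h ▸ Sig.zero_mem)
    rw [Algebra.algebraMap_eq_smul_one, ← expo_zero, bohrCoeff_smul c (expo_mem 0),
      bohrCoeff_expo, if_neg h0, mul_zero]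

/-- `APW^k_Σ`: the functions of `AP^k_Σ` with absolutely convergent Bohr-Fourier series. -/
def APWOn (Sig : AddSubmonoid (Fin k → ℝ)) : Subalgebra ℂ ((Fin k → ℝ) →ᵇ ℂ) where
  carrier := {f | f ∈ AP k ∧ (Summable fun l => ‖bohrCoeff f l‖) ∧ bohrSpectrum f ⊆ Sig}
  mul_mem' := by
    rintro f g ⟨hf, hfW, hfs⟩ ⟨hg, hgW, hgs⟩
    refine ⟨mul_mem hf hg, ?_, ((APOn Sig).mul_mem ⟨hf, hfs⟩ ⟨hg, hgs⟩).2⟩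
    have h1 : Summable fun p : (Fin k → ℝ) × (Fin k → ℝ) =>
        ‖bohrCoeff f p.2‖ * ‖bohrCoeff g (p.1 - p.2)‖ := by
      have h := (hgW.mul_of_nonneg hfW (fun _ => norm_nonneg _) (fun _ => norm_nonneg _))
      let sh : (Fin k → ℝ) × (Fin k → ℝ) ≃ (Fin k → ℝ) × (Fin k → ℝ) :=
        { toFun := fun p => (p.1 - p.2, p.2)
          invFun := fun p => (p.1 + p.2, p.2)
          left_inv := fun p => by simp
          right_inv := fun p => by simp }
      exact (sh.summable_iff.2 h).congr fun p => mul_comm _ _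
    refine Summable.of_nonneg_of_le (fun _ => norm_nonneg _) (fun l => ?_) h1.prod
    rw [← (hasSum_bohrCoeff_mul hf hg l).tsum_eq]
    simp_rw [← norm_mul]
    refine norm_tsum_le_tsum_norm ?_
    simpa using h1.prod_factor l
  add_mem' := by
    rintro f g ⟨hf, hfW, hfs⟩ ⟨hg, hgW, hgs⟩
    refine ⟨add_mem hf hg, ?_, ((APOn Sig).add_mem ⟨hf, hfs⟩ ⟨hg, hgs⟩).2⟩
    refine Summable.of_nonneg_of_le (fun _ => norm_nonneg _) (fun l => ?_) (hfW.add hgW)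
    rw [bohrCoeff_add hf hg]
    exact norm_add_le _ _
  algebraMap_mem' := by
    intro c
    obtain ⟨h1, h2⟩ := (APOn Sig).algebraMap_mem c
    refine ⟨h1, summable_of_ne_finset_zero (s := {0}) fun l hl => ?_, h2⟩
    have h0 : (0 : Fin k → ℝ) ≠ l := fun h => hl (by simp [h])
    rw [Algebra.algebraMap_eq_smul_one, ← expo_zero, bohrCoeff_smul c (expo_mem 0),
      bohrCoeff_expo, if_neg h0, mul_zero, norm_zero]

/-- The maximal ideal space of a commutative unital Banach algebra `A`: the nonzero multiplicative
linear functionals, that is, the unital algebra homomorphisms to `ℂ`. They are automatically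
bounded for any norm making `A` a Banach algebra, so that no norm on `A` enters here. -/
def MaximalIdealSpace (A : Type*) [CommRing A] [Algebra ℂ A] : Type _ := A →ₐ[ℂ] ℂ

/-- The weak-* topology: the coarsest one for which all evaluations `φ ↦ φ a` are continuous. -/
instance instTopologicalSpaceMaximalIdealSpace (A : Type*) [CommRing A] [Algebra ℂ A] :
    TopologicalSpace (MaximalIdealSpace A) :=
  TopologicalSpace.induced (fun (φ : A →ₐ[ℂ] ℂ) (a : A) => φ a) inferInstance

end AlmostPeriodic

end

open Filter Topology MeasureTheory
open scoped BoundedContinuousFunction Pointwise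

noncomputable section

namespace AlmostPeriodic

variable {k : ℕ}

/-! ### Polynomial growth in commutative monoids -/

section Growth

variable {G : Type*} [AddCommMonoid G]

open Classical in
/-- The elements `∑ i ∈ s, n i • i` with coefficients `n i ≤ N`. -/
def growthBox (s : Finset G) (N : ℕ) : Finset G :=
  (Fintype.piFinset fun _ : s => Finset.range (N + 1)).image fun n => ∑ i : s, n i • (i : G)

lemma mem_growthBox {s : Finset G} {N : ℕ} {x : G} :
    x ∈ growthBox s N ↔ ∃ n : s → ℕ, (∀ i, n i ≤ N) ∧ ∑ i : s, n i • (i : G) = x := by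
  simp [growthBox, Fintype.mem_piFinset]

/-- Polynomial in `N` for fixed `s`: by commutativity only the multiplicities of the summands
matter. -/
lemma card_growthBox_le (s : Finset G) (N : ℕ) :
    (growthBox s N).card ≤ (N + 1) ^ s.card := by
  classical
  refine Finset.card_image_le.trans ?_
  simp [Fintype.card_piFinset]

lemma zero_mem_growthBox (s : Finset G) (N : ℕ) : (0 : G) ∈ growthBox s N :=
  mem_growthBox.2 ⟨0, by simp, by simp⟩

lemma growthBox_subset_succ (s : Finset G) (N : ℕ) : growthBox s N ⊆ growthBox s (N + 1) := by
  intro x hx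
  obtain ⟨n, hn, rfl⟩ := mem_growthBox.1 hx
  exact mem_growthBox.2 ⟨n, fun i => (hn i).trans (Nat.le_succ N), rfl⟩

lemma add_mem_growthBox_succ {s : Finset G} {N : ℕ} {x y : G} (hx : x ∈ growthBox s N)
    (hy : y ∈ s) : x + y ∈ growthBox s (N + 1) := by
  classical
  obtain ⟨n, hn, rfl⟩ := mem_growthBox.1 hx
  refine mem_growthBox.2 ⟨n + Pi.single ⟨y, hy⟩ 1, fun i => ?_, ?_⟩
  · have := hn i
    by_cases h : i = ⟨y, hy⟩
    · subst h; simpa using this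
    · simp [h]; omega
  · simp only [Pi.add_apply, add_smul, Finset.sum_add_distrib]
    congr 1
    rw [Finset.sum_eq_single ⟨y, hy⟩]
    · simp
    · intro b _ hb; simp [hb]
    · simp

end Growth

/-- A geometric sequence with polynomial growth does not grow. -/
lemma le_one_of_pow_le {r : ℝ} {d : ℕ} (h : ∀ n : ℕ, r ^ n ≤ ((n : ℝ) + 1) ^ d) : r ≤ 1 := by
  by_contra! hr
  -- The exponent `n + 1` makes this the sequence `n ^ d / r ^ n` shifted by one.
  have h1 : Tendsto (fun n : ℕ => ((n : ℝ) + 1) ^ d / r ^ (n + 1)) atTop (𝓝 0) := by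
    have := (tendsto_pow_const_div_const_pow_of_one_lt d hr).comp (tendsto_add_atTop_nat 1)
    refine this.congr fun n => ?_
    simp
  have h2 : ∀ n : ℕ, r⁻¹ ≤ ((n : ℝ) + 1) ^ d / r ^ (n + 1) := fun n => by
    have hr0 : 0 < r := by linarith
    rw [le_div_iff₀ (by positivity), pow_succ]
    calc r⁻¹ * (r ^ n * r) = r ^ n := by field_simp
      _ ≤ _ := h n
  have h3 := ge_of_tendsto' h1 h2
  have : 0 < r⁻¹ := by positivity
  linarith

open Classical in
/-- Finite subsets of commutative groups admit almost invariant finite sets. -/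
lemma exists_almost_invariant {G : Type*} [AddCommGroup G] (s : Finset G) {δ : ℝ} (hδ : 0 < δ) :
    ∃ B : Finset G, B.Nonempty ∧
      ∀ m ∈ s, (1 - δ) * (B.card : ℝ) ≤ ((B ×ˢ B).filter fun p : G × G => p.1 - p.2 = m).card := by
  -- If every enlargement of the box multiplied its size by more than `1 + δ`, the growth would be
  -- exponential.
  obtain ⟨N, hN⟩ : ∃ N : ℕ, ((growthBox s (N + 1)).card : ℝ) ≤ (1 + δ) * (growthBox s N).card := by
    by_contra! hc
    have h1 : ∀ n : ℕ, (1 + δ) ^ n ≤ ((growthBox s n).card : ℝ) := by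
      intro n
      induction n with
      | zero =>
        have : 0 < (growthBox s 0).card := Finset.card_pos.2 ⟨0, zero_mem_growthBox s 0⟩
        rw [pow_zero]; exact_mod_cast this
      | succ n ih =>
        rw [pow_succ, mul_comm]
        exact (mul_le_mul_of_nonneg_left ih (by linarith)).trans (hc n).le
    have h2 : (1 + δ) ≤ 1 := le_one_of_pow_le (d := s.card) fun n =>
      (h1 n).trans (by exact_mod_cast card_growthBox_le s n)
    linarith
  refine ⟨growthBox s N, ⟨0, zero_mem_growthBox s N⟩, fun m hm => ?_⟩
  set B := growthBox s N with hB
  set C := B.image (· + m) with hC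
  have hCc : C.card = B.card := Finset.card_image_of_injective _ (add_left_injective m)
  have hU : (B ∪ C).card ≤ (growthBox s (N + 1)).card := by
    refine Finset.card_le_card (Finset.union_subset (growthBox_subset_succ s N) ?_)
    intro x hx
    obtain ⟨y, hy, rfl⟩ := Finset.mem_image.1 hx
    exact add_mem_growthBox_succ hy hm
  -- Both `B` and its translate `C` lie in the next box, so their union has at most `(1 + δ)|B|`
  -- elements and their intersection at least `(1 - δ)|B|`.
  have hI : (B ∩ C).card ≤ ((B ×ˢ B).filter fun p : G × G => p.1 - p.2 = m).card := by
    refine Finset.card_le_card_of_injOn (fun x => (x, x - m)) ?_ ?_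
    · intro x hx
      obtain ⟨hx1, hx2⟩ := Finset.mem_inter.1 hx
      obtain ⟨y, hy, rfl⟩ := Finset.mem_image.1 hx2
      simp [hx1, hy]
    · intro x _ y _ h
      exact (Prod.ext_iff.1 h).1
  have hUI := Finset.card_union_add_card_inter B C
  have h1 : ((B ∪ C).card : ℝ) + (B ∩ C).card = B.card + B.card := by
    rw [hCc] at hUI; exact_mod_cast hUI
  have h2 : ((B ∪ C).card : ℝ) ≤ (growthBox s (N + 1)).card := by exact_mod_cast hU
  have h3 : ((B ∩ C).card : ℝ) ≤ ((B ×ˢ B).filter fun p : G × G => p.1 - p.2 = m).card := by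
    exact_mod_cast hI
  linarith

/-! ### Semicharacters and faces of a halfspace -/

/-- The multiplicative maps from `Σ` to the closed unit disc, with the pointwise topology. -/
abbrev Semichar (Sig : AddSubmonoid (Fin k → ℝ)) : Type :=
  {χ : Sig → ℂ // χ 0 = 1 ∧ (∀ l m, χ (l + m) = χ l * χ m) ∧ ∀ l, ‖χ l‖ ≤ 1}

/-- A subspace `W` cuts out a face of `S` if a sum of elements of `S` lies in `W` only when both
summands do. -/
def IsFace (S : Set (Fin k → ℝ)) (W : Submodule ℝ (Fin k → ℝ)) : Prop :=
  ∀ l ∈ S, ∀ m ∈ S, l + m ∈ W → l ∈ W ∧ m ∈ W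

lemma IsHalfspace.zero_mem {S : Set (Fin k → ℝ)} (hS : IsHalfspace S) : (0 : Fin k → ℝ) ∈ S :=
  (hS.inter_neg.symm.subset rfl).1

/-- If `l + m = 0`, then `l` lies in `S ∩ -S = {0}`. This is the face at which the descent ends. -/
lemma IsHalfspace.isFace_bot {S : Set (Fin k → ℝ)} (hS : IsHalfspace S) : IsFace S ⊥ := by
  intro l hl m hm h
  rw [Submodule.mem_bot] at h
  have h1 : l = 0 := by
    have : l ∈ S ∩ -S := ⟨hl, by rwa [Set.mem_neg, neg_eq_of_add_eq_zero_right h]⟩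
    rwa [hS.inter_neg] at this
  subst h1
  simp_all

/-- A nonzero subspace carries a nonzero functional which is nonnegative on the halfspace. -/
lemma IsHalfspace.exists_functional {S : Set (Fin k → ℝ)} (hS : IsHalfspace S)
    {W : Submodule ℝ (Fin k → ℝ)} (hW : W ≠ ⊥) :
    ∃ f : (Fin k → ℝ) →ₗ[ℝ] ℝ, (∀ x ∈ S, x ∈ W → 0 ≤ f x) ∧ ∃ x ∈ W, f x ≠ 0 := by
  set C : Set W := {x | (x : Fin k → ℝ) ∈ S} with hC
  have hconv : Convex ℝ C := by
    intro x hx y hy a b ha hb _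
    exact hS.add_mem _ (hS.smul_mem _ hx a ha) _ (hS.smul_mem _ hy b hb)
  have hcover : ∀ x : W, x ∈ C ∨ -x ∈ C := by
    intro x
    have : (x : Fin k → ℝ) ∈ S ∪ -S := by rw [hS.union_neg]; trivial
    simpa [hC] using this
  have h0 : (0 : W) ∈ C := hS.zero_mem
  -- `C ∪ -C` is all of `W` and `0 ∈ C`, so nothing is missed; in finite dimension the convex set
  -- `C` then has interior points.
  have hspan : affineSpan ℝ C = ⊤ := by
    refine eq_top_iff.2 fun x _ => ?_
    rcases hcover x with hx | hx
    · exact subset_affineSpan ℝ C hx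
    · have := AffineMap.lineMap_mem (-1 : ℝ) (subset_affineSpan ℝ C h0) (subset_affineSpan ℝ C hx)
      simpa [AffineMap.lineMap_apply] using this
  have hint : (interior C).Nonempty := hconv.interior_nonempty_iff_affineSpan_eq_top.2 hspan
  -- Otherwise `C` would contain small multiples of `x` and of `-x` for every `x ∈ W`, forcing `x ∈
  -- S ∩ -S`.
  have h0' : (0 : W) ∉ interior C := by
    intro h
    apply hW
    rw [Submodule.eq_bot_iff]
    intro x hx
    have ht : ∀ᶠ t : ℝ in 𝓝[>] 0, t • (⟨x, hx⟩ : W) ∈ C ∧ (-t) • (⟨x, hx⟩ : W) ∈ C := by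
      have hC0 : C ∈ 𝓝 (0 : W) := mem_interior_iff_mem_nhds.1 h
      have h1 : Tendsto (fun t : ℝ => t • (⟨x, hx⟩ : W)) (𝓝 0) (𝓝 0) :=
        Continuous.tendsto' (by fun_prop) _ _ (by simp)
      have h2 : Tendsto (fun t : ℝ => (-t) • (⟨x, hx⟩ : W)) (𝓝 0) (𝓝 0) :=
        Continuous.tendsto' (by fun_prop) _ _ (by simp)
      exact ((h1.eventually_mem hC0).and (h2.eventually_mem hC0)).filter_mono nhdsWithin_le_nhds
    obtain ⟨t, ⟨h1, h2⟩, h3⟩ := (ht.and self_mem_nhdsWithin).exists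
    have h3' : (0 : ℝ) < t := h3
    have h4 := hS.smul_mem _ h1 t⁻¹ (by positivity)
    have h5 := hS.smul_mem _ h2 t⁻¹ (by positivity)
    simp only [Submodule.coe_smul, smul_smul, inv_mul_cancel₀ h3'.ne', neg_smul,
      one_smul, smul_neg] at h4 h5
    have h6 : x ∈ S ∩ -S := ⟨h4, h5⟩
    rwa [hS.inter_neg] at h6
  obtain ⟨f, hf⟩ := geometric_hahn_banach_open_point hconv.interior isOpen_interior h0'
  have hfC : ∀ x ∈ C, f x ≤ 0 := by
    intro x hx
    have h1 : x ∈ closure (interior C) := by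
      rw [hconv.closure_interior_eq_closure_of_nonempty_interior hint]
      exact subset_closure hx
    have h2 : closure (interior C) ⊆ {y | f y ≤ 0} :=
      closure_minimal (fun y hy => by simpa using (hf y hy).le)
        (isClosed_le f.continuous continuous_const)
    exact h2 h1
  -- The separating `f` is negative on the interior of `C`, so the functional sought is the negative
  -- of its extension, and any interior point shows that it is nonzero on `W`.
  obtain ⟨g, hg⟩ := LinearMap.exists_extend (p := W) (f : W →ₗ[ℝ] ℝ)
  have hg' : ∀ x : W, g x = f x := fun x => LinearMap.congr_fun hg x
  refine ⟨-g, fun x hx hxW => ?_, ?_⟩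
  · have := hfC ⟨x, hxW⟩ hx
    rw [← hg'] at this
    simpa using this
  · obtain ⟨x, hx⟩ := hint
    refine ⟨x, x.2, ?_⟩
    have := hf x hx
    rw [← hg', map_zero] at this
    simpa using this.ne

/-- Cutting a functional which is nonnegative on the face cuts out a smaller face. -/
lemma IsFace.inf_ker {S : Set (Fin k → ℝ)} {W : Submodule ℝ (Fin k → ℝ)} (hW : IsFace S W)
    {f : (Fin k → ℝ) →ₗ[ℝ] ℝ} (hf : ∀ x ∈ S, x ∈ W → 0 ≤ f x) :
    IsFace S (W ⊓ LinearMap.ker f) := by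
  intro l hl m hm h
  obtain ⟨h1, h2⟩ := Submodule.mem_inf.1 h
  obtain ⟨hlW, hmW⟩ := hW l hl m hm h1
  have h3 := hf l hl hlW
  have h4 := hf m hm hmW
  rw [LinearMap.mem_ker, map_add] at h2
  exact ⟨⟨hlW, LinearMap.mem_ker.2 (by linarith)⟩, ⟨hmW, LinearMap.mem_ker.2 (by linarith)⟩⟩

/-! ### Contraction of the space of semicharacters -/

namespace Semichar

variable {S : Set (Fin k → ℝ)} {Sig : AddSubmonoid (Fin k → ℝ)}

lemma continuous_eval (l : Sig) : Continuous fun χ : Semichar Sig => χ.1 l :=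
  (continuous_apply l).comp continuous_subtype_val

open Classical in
/-- The semicharacter `l ↦ χ l * t ^ f l` on the face `W`, extended by zero. -/
def damp (hSig : (Sig : Set (Fin k → ℝ)) ⊆ S) {W : Submodule ℝ (Fin k → ℝ)} (hW : IsFace S W)
    {f : (Fin k → ℝ) →ₗ[ℝ] ℝ} (hf : ∀ x ∈ S, x ∈ W → 0 ≤ f x) (t : unitInterval)
    (χ : Semichar Sig) : Semichar Sig :=
  ⟨fun l => if (l : Fin k → ℝ) ∈ W then χ.1 l * (((t : ℝ) ^ (f l) : ℝ) : ℂ) else 0, by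
    refine ⟨?_, fun l m => ?_, fun l => ?_⟩
    · simp [χ.2.1]
    · have hl := hSig l.2
      have hm := hSig m.2
      beta_reduce
      by_cases h : ((l + m : Sig) : Fin k → ℝ) ∈ W
      -- The exponents are nonnegative, so `t ^ (a + b) = t ^ a * t ^ b` survives at `t = 0`, with
      -- `0 ^ 0 = 1`.
      · obtain ⟨h1, h2⟩ := hW l hl m hm h
        rw [if_pos h, if_pos h1, if_pos h2, χ.2.2.1, AddSubmonoid.coe_add, map_add,
          Real.rpow_add_of_nonneg t.2.1 (hf _ hl h1) (hf _ hm h2)]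
        push_cast
        ring
      · rw [if_neg h]
        by_cases h1 : (l : Fin k → ℝ) ∈ W
        · have h2 : (m : Fin k → ℝ) ∉ W := fun h2 => h (W.add_mem h1 h2)
          rw [if_neg h2, mul_zero]
        · rw [if_neg h1, zero_mul]
    · beta_reduce
      split_ifs with h
      · rw [norm_mul, Complex.norm_real, Real.norm_of_nonneg (Real.rpow_nonneg t.2.1 _)]
        exact mul_le_one₀ (χ.2.2.2 l) (Real.rpow_nonneg t.2.1 _)
          (Real.rpow_le_one t.2.1 t.2.2 (hf _ (hSig l.2) h))
      · simp⟩

/-- The topology is pointwise and the case distinction depends on `l` alone; continuity of the power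
at `t = 0` needs the exponent to be nonnegative. -/
lemma continuous_damp (hSig : (Sig : Set (Fin k → ℝ)) ⊆ S) {W : Submodule ℝ (Fin k → ℝ)}
    (hW : IsFace S W) {f : (Fin k → ℝ) →ₗ[ℝ] ℝ} (hf : ∀ x ∈ S, x ∈ W → 0 ≤ f x) :
    Continuous fun p : unitInterval × Semichar Sig => damp hSig hW hf p.1 p.2 := by
  refine Continuous.subtype_mk (continuous_pi fun l => ?_) _
  by_cases h : (l : Fin k → ℝ) ∈ W
  · simp only [h, if_true]
    refine ((continuous_eval l).comp continuous_snd).mul (Complex.continuous_ofReal.comp ?_)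
    exact (Real.continuous_rpow_const (hf _ (hSig l.2) h)).comp
      (continuous_subtype_val.comp continuous_fst)
  · simpa only [h, if_false] using continuous_const

/-- Cutting off a semicharacter outside a face. -/
def restrictFace (hSig : (Sig : Set (Fin k → ℝ)) ⊆ S) {W : Submodule ℝ (Fin k → ℝ)}
    (hW : IsFace S W) : C(Semichar Sig, Semichar Sig) :=
  ⟨damp hSig hW (f := 0) (fun _ _ _ => le_rfl) 1,
    (continuous_damp hSig hW (f := 0) fun _ _ _ => le_rfl).comp
      (continuous_const.prodMk continuous_id)⟩

open Classical in
lemma restrictFace_apply (hSig : (Sig : Set (Fin k → ℝ)) ⊆ S) {W : Submodule ℝ (Fin k → ℝ)}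
    (hW : IsFace S W) (χ : Semichar Sig) (l : Sig) :
    (restrictFace hSig hW χ).1 l = if (l : Fin k → ℝ) ∈ W then χ.1 l else 0 := by
  change (if _ then _ else _) = _
  simp

/-- The homotopy is `damp`: at `t = 0` the factor `0 ^ f l` is the indicator of `f l = 0`, at `t =
1` it is `1`. -/
lemma homotopic_restrictFace (hSig : (Sig : Set (Fin k → ℝ)) ⊆ S) {W : Submodule ℝ (Fin k → ℝ)}
    (hW : IsFace S W) {f : (Fin k → ℝ) →ₗ[ℝ] ℝ} (hf : ∀ x ∈ S, x ∈ W → 0 ≤ f x) :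
    (restrictFace hSig (hW.inf_ker hf)).Homotopic (restrictFace hSig hW) := by
  classical
  refine ⟨⟨⟨fun p => damp hSig hW hf p.1 p.2, continuous_damp hSig hW hf⟩, fun χ => ?_,
    fun χ => ?_⟩⟩
  · refine Subtype.ext (funext fun l => ?_)
    rw [restrictFace_apply]
    change (if _ then _ else _) = _
    by_cases h : (l : Fin k → ℝ) ∈ W
    · by_cases h0 : f l = 0
      · simp [h, h0]
      · simp [h, h0, Real.zero_rpow h0]
    · simp [h]
  · refine Subtype.ext (funext fun l => ?_)
    rw [restrictFace_apply]
    change (if _ then _ else _) = _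
    simp

/-- Induction on a bound for the dimension: the functional does not vanish on `W`, so its kernel
meets `W` in a smaller subspace. -/
lemma restrictFace_homotopic_bot (hS : IsHalfspace S) (hSig : (Sig : Set (Fin k → ℝ)) ⊆ S) :
    ∀ (n : ℕ) {W : Submodule ℝ (Fin k → ℝ)} (hW : IsFace S W), Module.finrank ℝ W ≤ n →
      (restrictFace hSig hW).Homotopic (restrictFace hSig hS.isFace_bot) := by
  intro n
  induction n with
  | zero =>
    intro W hW hn
    obtain rfl : W = ⊥ := Submodule.finrank_eq_zero.1 (Nat.le_zero.1 hn)
    exact .refl _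
  | succ n ih =>
    intro W hW hn
    by_cases hbot : W = ⊥
    · subst hbot; exact .refl _
    · obtain ⟨f, hf, x, hx, hfx⟩ := hS.exists_functional hbot
      refine (homotopic_restrictFace hSig hW hf).symm.trans (ih _ ?_)
      have hlt : W ⊓ LinearMap.ker f < W :=
        lt_of_le_of_ne inf_le_left fun h => hfx (inf_eq_left.1 h hx)
      have := Submodule.finrank_lt_finrank_of_lt hlt
      omega

/-- The space of semicharacters of a subsemigroup of a halfspace is contractible. -/
theorem contractibleSpace (hS : IsHalfspace S) (hSig : (Sig : Set (Fin k → ℝ)) ⊆ S) :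
    ContractibleSpace (Semichar Sig) := by
  classical
  rw [contractible_iff_id_nullhomotopic]
  have htop : IsFace S ⊤ := fun _ _ _ _ _ => ⟨trivial, trivial⟩
  -- The centre of the contraction is the indicator of `0`, multiplicative because `{0}` is a face.
  -- Restriction to `⊤` is the identity and restriction to `⊥` is constant, since `χ 0 = 1`.
  refine ⟨⟨fun l => if (l : Fin k → ℝ) = 0 then 1 else 0, by simp, fun l m => ?_, fun l => ?_⟩, ?_⟩
  · have := hS.isFace_bot l (hSig l.2) m (hSig m.2)
    simp only [Submodule.mem_bot] at this
    by_cases h : (l : Fin k → ℝ) = 0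
    · simp [h]
    · have h' : ¬ ((l : Fin k → ℝ) + m = 0) := fun h' => h (this h').1
      simp [h, h']
  · beta_reduce
    split_ifs <;> simp
  · convert restrictFace_homotopic_bot hS hSig _ htop le_rfl using 1
    · refine ContinuousMap.ext fun χ => ?_
      refine Subtype.ext (funext fun l => ?_)
      simp [restrictFace_apply]
    · refine ContinuousMap.ext fun χ => ?_
      refine Subtype.ext (funext fun l => ?_)
      rw [restrictFace_apply]
      by_cases h : l = 0
      · subst h; simpa using χ.2.1.symm
      · simp [h]

end Semichar

/-! ### Bochner-Fejér approximation -/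

/-- `star d * d = |d|²` is a nonnegative weight, so the bound holds for the cube averages and passes
to the limit. -/
lemma norm_bohrMean_mul_star_mul_le {f d : (Fin k → ℝ) →ᵇ ℂ} (hf : f ∈ AP k) (hd : d ∈ AP k) :
    ‖bohrMean (f * (star d * d) : (Fin k → ℝ) →ᵇ ℂ)‖
      ≤ ‖f‖ * (bohrMean (star d * d : (Fin k → ℝ) →ᵇ ℂ)).re := by
  have hdd := mul_mem (star_mem hd) hd
  refine le_of_tendsto_of_tendsto (tendsto_cubeAvg (mul_mem hf hdd)).norm
    (((Complex.continuous_re.tendsto _).comp (tendsto_cubeAvg hdd)).const_mul _) ?_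
  filter_upwards [eventually_gt_atTop 0] with T hT
  set Q := Set.Icc (fun _ : Fin k => -T) (fun _ : Fin k => T) with hQ
  have hp : 0 < (2 * T) ^ k := by positivity
  have hdx : ∀ x, (star d * d : (Fin k → ℝ) →ᵇ ℂ) x = ((‖d x‖ ^ 2 : ℝ) : ℂ) := fun x => by
    simp [Complex.conj_mul']
  have hre : (cubeAvg (star d * d : (Fin k → ℝ) →ᵇ ℂ) T).re
      = 1 / (2 * T) ^ k * ∫ x in Q, ‖d x‖ ^ 2 := by
    rw [cubeAvg, Complex.re_ofReal_mul]
    simp_rw [hdx]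
    rw [integral_complex_ofReal, Complex.ofReal_re]
  have hi : IntegrableOn (fun x => ‖d x‖ ^ 2) Q := (d.continuous.norm.pow 2).integrableOn_Icc
  have hpt : ‖∫ x in Q, (f * (star d * d) : (Fin k → ℝ) →ᵇ ℂ) x‖
      ≤ ∫ x in Q, ‖f‖ * ‖d x‖ ^ 2 := by
    refine norm_integral_le_of_norm_le (hi.const_mul _) (Eventually.of_forall fun x => ?_)
    rw [BoundedContinuousFunction.coe_mul, Pi.mul_apply, norm_mul, hdx, Complex.norm_real,
      Real.norm_of_nonneg (by positivity)]
    exact mul_le_mul_of_nonneg_right (f.norm_coe_le_norm x) (by positivity)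
  rw [integral_const_mul] at hpt
  change _ ≤ ‖f‖ * (cubeAvg _ T).re
  rw [hre, cubeAvg, norm_mul, Complex.norm_real, Real.norm_of_nonneg (by positivity)]
  calc _ ≤ 1 / (2 * T) ^ k * _ := mul_le_mul_of_nonneg_left hpt (by positivity)
    _ = _ := by ring

lemma bohrCoeff_sub {f g : (Fin k → ℝ) →ᵇ ℂ} (hf : f ∈ AP k) (hg : g ∈ AP k)
    (l : Fin k → ℝ) :
    bohrCoeff (f - g : (Fin k → ℝ) →ᵇ ℂ) l = bohrCoeff f l - bohrCoeff g l := by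
  simp only [bohrCoeff_eq]
  rw [mul_sub, bohrMean_sub (mul_mem (expo_mem _) hf) (mul_mem (expo_mem _) hg)]

lemma bohrCoeff_sum {ι : Type*} (F : Finset ι) (f : ι → (Fin k → ℝ) →ᵇ ℂ)
    (hf : ∀ i, f i ∈ AP k) (l : Fin k → ℝ) :
    bohrCoeff (∑ i ∈ F, f i : (Fin k → ℝ) →ᵇ ℂ) l = ∑ i ∈ F, bohrCoeff (f i) l := by
  simp only [bohrCoeff_eq]
  rw [Finset.mul_sum, bohrMean_sum _ _ fun i => mul_mem (expo_mem _) (hf i)]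

lemma norm_expo (l : Fin k → ℝ) : ‖expo l‖ = 1 := by
  refine le_antisymm (BoundedContinuousFunction.norm_ofNormedAddCommGroup_le _ zero_le_one _) ?_
  have := (expo l).norm_coe_le_norm 0
  simpa [expo_apply] using this

lemma norm_bohrCoeff_le {f : (Fin k → ℝ) →ᵇ ℂ} (hf : f ∈ AP k) (l : Fin k → ℝ) :
    ‖bohrCoeff f l‖ ≤ ‖f‖ := by
  rw [bohrCoeff_eq]
  refine (norm_bohrMean_le (mul_mem (expo_mem _) hf)).trans ((norm_mul_le _ _).trans ?_)
  rw [norm_expo, one_mul]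

/-- The Bochner-Fejér polynomial of `f` attached to a finite set of frequencies. -/
def fejer (B : Finset (Fin k → ℝ)) (f : (Fin k → ℝ) →ᵇ ℂ) : (Fin k → ℝ) →ᵇ ℂ :=
  (B.card : ℂ)⁻¹ • ∑ p ∈ B ×ˢ B, bohrCoeff f (p.1 - p.2) • expo (p.1 - p.2)

lemma fejer_sub (B : Finset (Fin k → ℝ)) {f g : (Fin k → ℝ) →ᵇ ℂ} (hf : f ∈ AP k)
    (hg : g ∈ AP k) : fejer B (f - g) = fejer B f - fejer B g := by
  simp only [fejer, bohrCoeff_sub hf hg, sub_smul, Finset.sum_sub_distrib, smul_sub]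

lemma fejer_sum {ι : Type*} (B : Finset (Fin k → ℝ)) (F : Finset ι) (c : ι → ℂ)
    (f : ι → (Fin k → ℝ) →ᵇ ℂ) (hf : ∀ i, f i ∈ AP k) :
    fejer B (∑ i ∈ F, c i • f i) = ∑ i ∈ F, c i • fejer B (f i) := by
  simp only [fejer]
  simp_rw [bohrCoeff_sum F (fun i => c i • f i) fun i => (AP k).smul_mem (hf i) _,
    bohrCoeff_smul _ (hf _), Finset.sum_smul]
  rw [Finset.sum_comm, Finset.smul_sum]
  refine Finset.sum_congr rfl fun i _ => ?_
  rw [smul_comm (c i), Finset.smul_sum (r := c i)]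
  simp_rw [smul_smul]

open Classical in
-- Exponentials are eigenvectors; the eigenvalue is the proportion of `B` that lies in its translate
-- by `m`, close to `1` when `B` is almost invariant.
lemma fejer_expo (B : Finset (Fin k → ℝ)) (m : Fin k → ℝ) :
    fejer B (expo m) = ((B.card : ℂ)⁻¹ *
      ((B ×ˢ B).filter fun p : (Fin k → ℝ) × (Fin k → ℝ) => p.1 - p.2 = m).card) • expo m := by
  rw [fejer, mul_smul]
  congr 1
  rw [Finset.card_filter, Nat.cast_sum, Finset.sum_smul]
  refine Finset.sum_congr rfl fun p _ => ?_
  rw [bohrCoeff_expo]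
  by_cases h : p.1 - p.2 = m
  · simp [h]
  · simp [h, Ne.symm h]

/-- The Fejér operator averages `f` against the nonnegative kernel `|d|² / |B|`, whose mean is `1`.
-/
lemma norm_fejer_le {B : Finset (Fin k → ℝ)} (hB : B.Nonempty) {f : (Fin k → ℝ) →ᵇ ℂ}
    (hf : f ∈ AP k) : ‖fejer B f‖ ≤ ‖f‖ := by
  classical
  rw [BoundedContinuousFunction.norm_le (norm_nonneg f)]
  intro x
  have hB0 : (0 : ℝ) < B.card := by exact_mod_cast hB.card_pos
  -- As a function of `y` this is `∑ e_b(y - x)`, the kernel recentred at `x`.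
  set d : (Fin k → ℝ) →ᵇ ℂ := ∑ b ∈ B, expo (-b) x • expo b with hd
  have hdm : d ∈ AP k := sum_mem fun _ _ => (AP k).smul_mem (expo_mem _) _
  have hdd : star d * d
      = ∑ p ∈ B ×ˢ B, expo (p.1 - p.2) x • expo (-(p.1 - p.2)) := by
    rw [hd, star_sum, Finset.sum_mul_sum, ← Finset.sum_product']
    refine Finset.sum_congr rfl fun p _ => ?_
    have hs : star (expo (-p.1) x) = expo p.1 x := by
      rw [← BoundedContinuousFunction.star_apply, star_expo, neg_neg]
    rw [star_smul, star_expo, smul_mul_smul_comm, hs, ← expo_add, sub_eq_add_neg, expo_add p.1]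
    simp [add_comm]
  have hM : ∀ g ∈ AP k, bohrMean (g * (star d * d) : (Fin k → ℝ) →ᵇ ℂ)
      = ∑ p ∈ B ×ˢ B, bohrCoeff g (p.1 - p.2) * expo (p.1 - p.2) x := by
    intro g hg
    rw [hdd, Finset.mul_sum,
      bohrMean_sum _ _ fun p => mul_mem hg ((AP k).smul_mem (expo_mem _) _)]
    refine Finset.sum_congr rfl fun p _ => ?_
    rw [mul_smul_comm, bohrMean_smul _ (mul_mem hg (expo_mem _)), mul_comm g, ← bohrCoeff_eq,
      mul_comm]
  have h1 : bohrMean (star d * d : (Fin k → ℝ) →ᵇ ℂ) = B.card := by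
    have := hM 1 (one_mem _)
    rw [one_mul] at this
    rw [this, Finset.sum_product]
    have : ∀ b ∈ B, ∑ c ∈ B, bohrCoeff (1 : (Fin k → ℝ) →ᵇ ℂ) (b - c) * expo (b - c) x = 1 := by
      intro b hb
      rw [Finset.sum_eq_single b]
      · rw [sub_self, ← expo_zero, bohrCoeff_expo]; simp [expo_zero]
      · intro c _ hc
        rw [← expo_zero, bohrCoeff_expo, if_neg (sub_ne_zero.2 hc.symm).symm, zero_mul]
      · exact fun h => absurd hb h
    rw [Finset.sum_congr rfl this]
    simp
  have h2 := norm_bohrMean_mul_star_mul_le hf hdm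
  rw [h1, hM f hf, Complex.natCast_re] at h2
  have h3 : fejer B f x
      = (B.card : ℂ)⁻¹ * ∑ p ∈ B ×ˢ B, bohrCoeff f (p.1 - p.2) * expo (p.1 - p.2) x := by
    simp [fejer]
  rw [h3, norm_mul, norm_inv, Complex.norm_natCast, inv_mul_le_iff₀ hB0, mul_comm]
  exact h2

/-- Almost periodic functions are approximated by their Bochner-Fejér polynomials. -/
theorem exists_norm_sub_fejer_lt {f : (Fin k → ℝ) →ᵇ ℂ} (hf : f ∈ AP k) {ε : ℝ} (hε : 0 < ε) :
    ∃ B : Finset (Fin k → ℝ), B.Nonempty ∧ ‖f - fejer B f‖ < ε := by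
  classical
  obtain ⟨p, hp, hfp⟩ := Metric.mem_closure_iff.1 (mem_AP_iff.1 hf) (ε / 4) (by linarith)
  obtain ⟨c, rfl⟩ := Finsupp.mem_span_range_iff_exists_finsupp.1 hp
  set C := ∑ m ∈ c.support, ‖c m‖ with hC
  have hC0 : 0 ≤ C := Finset.sum_nonneg fun _ _ => norm_nonneg _
  -- Chosen so that `C * δ ≤ ε / 4`; the `1` covers `C = 0`.
  set δ := ε / (4 * (C + 1)) with hδ
  have hδ0 : 0 < δ := by positivity
  obtain ⟨B, hB, hBm⟩ := exists_almost_invariant c.support hδ0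
  refine ⟨B, hB, ?_⟩
  have hB0 : (0 : ℝ) < B.card := by exact_mod_cast hB.card_pos
  set q : (Fin k → ℝ) →ᵇ ℂ := ∑ m ∈ c.support, c m • expo m with hq
  have hqm : q ∈ AP k := sum_mem fun _ _ => (AP k).smul_mem (expo_mem _) _
  have hfq : ‖f - q‖ < ε / 4 := by rw [← dist_eq_norm]; exact hfp
  have hqq : ‖q - fejer B q‖ ≤ ε / 4 := by
    rw [hq, fejer_sum B c.support c expo expo_mem, ← Finset.sum_sub_distrib]
    refine (norm_sum_le _ _).trans ?_
    have : ∀ m ∈ c.support, ‖c m • expo m - c m • fejer B (expo m)‖ ≤ ‖c m‖ * δ := by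
      intro m hm
      rw [← smul_sub, norm_smul]
      refine mul_le_mul_of_nonneg_left ?_ (norm_nonneg _)
      set r := ((B ×ˢ B).filter fun p : (Fin k → ℝ) × (Fin k → ℝ) => p.1 - p.2 = m).card with hr
      have h1 : (1 - δ) * (B.card : ℝ) ≤ r := by convert hBm m hm
      have h2 : (r : ℝ) ≤ B.card := by
        have : r ≤ B.card := by
          refine Finset.card_le_card_of_injOn Prod.snd ?_ ?_
          · intro p hp
            exact (Finset.mem_product.1 (Finset.mem_filter.1 hp).1).2
          · intro p hp p' hp' h
            have e1 := (Finset.mem_filter.1 hp).2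
            have e2 := (Finset.mem_filter.1 hp').2
            refine Prod.ext ?_ h
            rw [sub_eq_iff_eq_add.1 e1, sub_eq_iff_eq_add.1 e2, h]
        exact_mod_cast this
      rw [fejer_expo, ← hr]
      have e : expo m - ((B.card : ℂ)⁻¹ * (r : ℂ)) • expo m
          = ((1 - (B.card : ℝ)⁻¹ * r : ℝ) : ℂ) • expo m := by
        push_cast; rw [sub_smul, one_smul]
      rw [e, norm_smul, norm_expo, mul_one, Complex.norm_real, Real.norm_eq_abs, abs_le]
      have e3 : 1 - δ ≤ (B.card : ℝ)⁻¹ * r := by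
        rw [inv_mul_eq_div, le_div_iff₀ hB0]; exact h1
      have e4 : (B.card : ℝ)⁻¹ * r ≤ 1 := by
        rw [inv_mul_eq_div, div_le_one hB0]; exact h2
      constructor <;> linarith
    refine (Finset.sum_le_sum this).trans ?_
    rw [← Finset.sum_mul, ← hC, hδ, mul_div_assoc', div_le_iff₀ (by positivity)]
    nlinarith
  have h3 : ‖fejer B (f - q)‖ ≤ ‖f - q‖ := norm_fejer_le hB (sub_mem hf hqm)
  -- The outer terms are small since the Fejér operator is a contraction, the middle one since `B`
  -- is almost invariant under the frequencies of `q`.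
  have h4 : f - fejer B f = (f - q) + (q - fejer B q) - fejer B (f - q) := by
    rw [fejer_sub B hf hqm]; abel
  rw [h4]
  have h5 := norm_sub_le ((f - q) + (q - fejer B q)) (fejer B (f - q))
  have h6 := norm_add_le (f - q) (q - fejer B q)
  linarith

/-- The sup norm is bounded by the Wiener norm. -/
lemma norm_le_tsum_norm_bohrCoeff {f : (Fin k → ℝ) →ᵇ ℂ} (hf : f ∈ AP k)
    (hs : Summable fun l => ‖bohrCoeff f l‖) : ‖f‖ ≤ ∑' l, ‖bohrCoeff f l‖ := by
  refine le_of_forall_pos_le_add fun ε hε => ?_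
  obtain ⟨B, hB, hfB⟩ := exists_norm_sub_fejer_lt hf hε
  have hB0 : (0 : ℝ) < B.card := by exact_mod_cast hB.card_pos
  -- For each fixed `c ∈ B` the coefficients at the `b - c` are distinct terms of the Wiener sum;
  -- the factor `1 / |B|` averages over `c`.
  have h1 : ‖fejer B f‖ ≤ ∑' l, ‖bohrCoeff f l‖ := by
    rw [fejer, norm_smul, norm_inv, Complex.norm_natCast, inv_mul_le_iff₀ hB0]
    refine (norm_sum_le _ _).trans ?_
    simp_rw [norm_smul, norm_expo, mul_one]
    rw [Finset.sum_product_right, ← nsmul_eq_mul]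
    refine Finset.sum_le_card_nsmul _ _ _ fun c _ => ?_
    have h2 : Summable fun b => ‖bohrCoeff f (b - c)‖ := (Equiv.subRight c).summable_iff.2 hs
    refine (h2.sum_le_tsum _ fun _ _ => norm_nonneg _).trans_eq ?_
    exact (Equiv.subRight c).tsum_eq fun l => ‖bohrCoeff f l‖
  have := norm_sub_norm_le f (fejer B f)
  linarith

/-- Functions with spectrum in `Σ` are uniform limits of polynomials with spectrum in `Σ`. -/
lemma exists_mem_span_norm_sub_lt {Sig : AddSubmonoid (Fin k → ℝ)} {f : (Fin k → ℝ) →ᵇ ℂ}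
    (hf : f ∈ APOn Sig) {ε : ℝ} (hε : 0 < ε) :
    ∃ p ∈ Submodule.span ℂ (Set.range fun l : Sig => expo (l : Fin k → ℝ)), ‖f - p‖ < ε := by
  obtain ⟨B, -, hfB⟩ := exists_norm_sub_fejer_lt hf.1 hε
  refine ⟨fejer B f, Submodule.smul_mem _ _ (Submodule.sum_mem _ fun p _ => ?_), hfB⟩
  -- `B` need not lie in `Σ`: differences outside `Σ` carry a zero coefficient.
  by_cases h : p.1 - p.2 ∈ Sig
  · exact Submodule.smul_mem _ _ (Submodule.subset_span ⟨⟨_, h⟩, rfl⟩)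
  · rw [not_not.1 fun hne => h (hf.2 hne), zero_smul]
    exact zero_mem _

/-! ### Maximal ideal spaces as spaces of semicharacters -/

/-- If the characters of `A` are dominated by a size function `N`, and `A` is spanned, densely for
`N`, by a semigroup `e` of elements to which every semicharacter extends, then the maximal ideal
space of `A` is the space of semicharacters. -/
theorem nonempty_homeomorph_semichar {Sig : AddSubmonoid (Fin k → ℝ)} {A : Type*} [CommRing A]
    [Algebra ℂ A] (N : A → ℝ) (e : Multiplicative Sig →* A)
    (hN : ∀ (φ : A →ₐ[ℂ] ℂ) a, ‖φ a‖ ≤ N a) (hNe : ∀ l, N (e l) ≤ 1)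
    (hdense : ∀ a, ∀ ε > 0, ∃ p ∈ Submodule.span ℂ (Set.range e), N (a - p) < ε)
    (hext : ∀ χ : Semichar Sig, ∃ φ : A →ₐ[ℂ] ℂ, ∀ l : Sig, φ (e (.ofAdd l)) = χ.1 l) :
    Nonempty (MaximalIdealSpace A ≃ₜ Semichar Sig) := by
  let F : (A →ₐ[ℂ] ℂ) → Semichar Sig := fun φ =>
    ⟨fun l => φ (e (.ofAdd l)),
      by beta_reduce; rw [ofAdd_zero, map_one]; exact map_one φ,
      fun l m => by beta_reduce; rw [ofAdd_add, map_mul]; exact map_mul φ _ _,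
      fun l => (hN φ _).trans (hNe _)⟩
  choose G hG using hext
  have hGspan : ∀ p ∈ Submodule.span ℂ (Set.range e), Continuous fun χ => G χ p := by
    intro p hp
    induction hp using Submodule.span_induction with
    | mem x hx =>
      obtain ⟨l, rfl⟩ := hx
      exact (Semichar.continuous_eval l.toAdd).congr fun χ => (hG χ l.toAdd).symm
    | zero => simpa using continuous_const
    | add x y _ _ hx hy => simp only [map_add]; exact hx.add hy
    | smul c x _ hx => simp only [map_smul, smul_eq_mul]; exact hx.const_mul c
  have hcont : Continuous (Y := MaximalIdealSpace A) G := by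
    refine continuous_induced_rng.2 (continuous_pi fun a => ?_)
    -- The error at `a` is at most `N (a - p)` for all `χ` at once, so continuity passes from the
    -- span to `a` by uniform limits.
    refine continuous_of_uniform_approx_of_continuous fun u hu => ?_
    obtain ⟨ε, hε, hεu⟩ := Metric.mem_uniformity_dist.1 hu
    obtain ⟨p, hp, hap⟩ := hdense a ε hε
    refine ⟨fun χ => G χ p, hGspan p hp, fun χ => hεu (lt_of_le_of_lt ?_ hap)⟩
    have := hN (G χ) (a - p)
    rwa [map_sub, ← dist_eq_norm] at this
  refine ⟨⟨⟨F, G, fun φ : A →ₐ[ℂ] ℂ => ?_, fun χ => Subtype.ext (funext fun l => hG χ l)⟩, ?_, ?_⟩⟩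
  · have hspan : ∀ p ∈ Submodule.span ℂ (Set.range e),
        G (F φ) p = φ p := by
      intro p hp
      induction hp using Submodule.span_induction with
      | mem x hx => obtain ⟨l, rfl⟩ := hx; exact hG (F φ) l
      | zero => simp
      | add x y _ _ hx hy => simp [hx, hy]
      | smul c x _ hx => simp [hx]
    refine AlgHom.ext fun a => eq_of_forall_dist_le fun ε hε => ?_
    obtain ⟨p, hp, hap⟩ := hdense a (ε / 2) (by linarith)
    have h1 := hN (G (F φ)) (a - p)
    have h2 := hN φ (a - p)
    rw [map_sub, ← dist_eq_norm] at h1 h2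
    rw [hspan p hp] at h1
    have := dist_triangle_right (G (F φ) a) (φ a) (φ p)
    linarith
  · refine Continuous.subtype_mk (continuous_pi fun l => ?_) _
    exact (continuous_apply (e (.ofAdd l))).comp continuous_induced_dom
  · exact hcont

/-! ### The algebra `AP^k_Σ` -/

variable {Sig : AddSubmonoid (Fin k → ℝ)}

lemma isClosed_AP : IsClosed (AP k : Set ((Fin k → ℝ) →ᵇ ℂ)) :=
  Subalgebra.isClosed_topologicalClosure _

/-- Each Bohr-Fourier coefficient is continuous for the sup norm. The resulting completeness makes
every character contractive. -/
lemma isClosed_APOn : IsClosed (APOn Sig : Set ((Fin k → ℝ) →ᵇ ℂ)) := by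
  refine isClosed_of_closure_subset fun f hf => ?_
  have hfA : f ∈ AP k := closure_minimal (fun g hg => hg.1) isClosed_AP hf
  refine ⟨hfA, fun l hl => by_contra fun hlS => ?_⟩
  obtain ⟨g, hg, hfg⟩ := Metric.mem_closure_iff.1 hf ‖bohrCoeff f l‖ (norm_pos_iff.2 hl)
  have h1 := norm_bohrCoeff_le (sub_mem hfA hg.1) l
  rw [bohrCoeff_sub hfA hg.1, not_not.1 fun hne => hlS (hg.2 hne), sub_zero,
    ← dist_eq_norm] at h1
  exact absurd hfg h1.not_gt

instance : CompleteSpace (APOn Sig) := isClosed_APOn.completeSpace_coe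

lemma expo_mem_APOn (l : Sig) : expo (l : Fin k → ℝ) ∈ APOn Sig := by
  refine ⟨expo_mem _, fun m hm => ?_⟩
  rw [bohrSpectrum, Set.mem_ofPred_eq, bohrCoeff_expo] at hm
  have : (l : Fin k → ℝ) = m := by by_contra h; simp [h] at hm
  exact this ▸ l.2

/-- The exponentials in `AP^k_Σ`. -/
def expoAP (Sig : AddSubmonoid (Fin k → ℝ)) : Multiplicative Sig →* APOn Sig where
  toFun l := ⟨expo (l.toAdd : Fin k → ℝ), expo_mem_APOn _⟩
  map_one' := Subtype.ext expo_zero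
  map_mul' _ _ := Subtype.ext (expo_add _ _)

lemma norm_char_le (φ : APOn Sig →ₐ[ℂ] ℂ) (f : APOn Sig) : ‖φ f‖ ≤ ‖f‖ := by
  have h := AlgHom.norm_apply_le_self_mul_norm_one φ f
  have h1 : ‖(1 : APOn Sig)‖ = 1 := norm_one (α := (Fin k → ℝ) →ᵇ ℂ)
  rwa [h1, mul_one] at h

lemma exists_mem_span_expoAP (f : APOn Sig) {ε : ℝ} (hε : 0 < ε) :
    ∃ p ∈ Submodule.span ℂ (Set.range (expoAP Sig)), ‖f - p‖ < ε := by
  obtain ⟨p, hp, hfp⟩ := exists_mem_span_norm_sub_lt f.2 hε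
  have hp' : p ∈ (Submodule.span ℂ (Set.range (expoAP Sig))).map (APOn Sig).val.toLinearMap := by
    rw [Submodule.map_span, ← Set.range_comp]
    exact hp
  obtain ⟨q, hq, rfl⟩ := hp'
  exact ⟨q, hq, hfp⟩

/-- Trigonometric polynomials with frequencies in `Σ`, as functions. -/
def trigPoly (Sig : AddSubmonoid (Fin k → ℝ)) : AddMonoidAlgebra ℂ Sig →ₐ[ℂ] APOn Sig :=
  AddMonoidAlgebra.lift ℂ (APOn Sig) Sig (expoAP Sig)

lemma bohrCoeff_trigPoly (p : AddMonoidAlgebra ℂ Sig) (l : Sig) :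
    bohrCoeff (trigPoly Sig p : (Fin k → ℝ) →ᵇ ℂ) l = p.coeff l := by
  classical
  have h : (trigPoly Sig p : (Fin k → ℝ) →ᵇ ℂ)
      = ∑ m ∈ p.coeff.support, p.coeff m • expo (m : Fin k → ℝ) := by
    rw [trigPoly, AddMonoidAlgebra.lift_apply, Finsupp.sum, AddSubmonoidClass.coe_finsetSum]
    rfl
  rw [h, bohrCoeff_sum _ _ fun m => (AP k).smul_mem (expo_mem _) _]
  simp_rw [bohrCoeff_smul _ (expo_mem _), bohrCoeff_expo]
  simp [eq_comm]

open Classical in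
-- A frequency of `p ^ n` is a sum of `n` frequencies of `p`, each used at most `n` times.
lemma support_coeff_pow_subset (p : AddMonoidAlgebra ℂ Sig) (n : ℕ) :
    (p ^ n).coeff.support ⊆ growthBox p.coeff.support n := by
  induction n with
  | zero =>
    rw [pow_zero]
    refine AddMonoidAlgebra.support_coeff_one_subset.trans fun x hx => ?_
    rw [Finset.mem_zero.1 hx]
    exact zero_mem_growthBox _ _
  | succ n ih =>
    rw [pow_succ]
    refine (AddMonoidAlgebra.support_coeff_mul_subset _ _).trans fun x hx => ?_
    obtain ⟨y, hy, z, hz, rfl⟩ := Finset.mem_add.1 hx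
    exact add_mem_growthBox_succ (ih hy) hz

/-- The evaluation of polynomials at a semicharacter. -/
def Semichar.eval (χ : Semichar Sig) : AddMonoidAlgebra ℂ Sig →ₐ[ℂ] ℂ :=
  AddMonoidAlgebra.lift ℂ ℂ Sig
    { toFun := fun l => χ.1 l.toAdd
      map_one' := χ.2.1
      map_mul' := fun l m => χ.2.2.1 l.toAdd m.toAdd }

/-- Crude bound, term by term: each coefficient is at most the sup norm. The cardinality is removed
by passing to powers. -/
lemma Semichar.norm_eval_le_card (χ : Semichar Sig) (p : AddMonoidAlgebra ℂ Sig) :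
    ‖χ.eval p‖ ≤ p.coeff.support.card * ‖trigPoly Sig p‖ := by
  rw [Semichar.eval, AddMonoidAlgebra.lift_apply, Finsupp.sum, ← nsmul_eq_mul]
  refine (norm_sum_le _ _).trans (Finset.sum_le_card_nsmul _ _ _ fun l _ => ?_)
  rw [norm_smul]
  refine (mul_le_of_le_one_right (norm_nonneg _) (χ.2.2.2 l)).trans ?_
  rw [← bohrCoeff_trigPoly]
  exact norm_bohrCoeff_le (trigPoly Sig p).2.1 _

/-- Semicharacters are contractive for the supremum norm. -/
lemma Semichar.norm_eval_le (χ : Semichar Sig) (p : AddMonoidAlgebra ℂ Sig) :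
    ‖χ.eval p‖ ≤ ‖trigPoly Sig p‖ := by
  have h : ∀ n : ℕ, ‖χ.eval p‖ ^ n ≤
      ((n : ℝ) + 1) ^ p.coeff.support.card * ‖trigPoly Sig p‖ ^ n := by
    intro n
    rw [← norm_pow, ← map_pow]
    refine (χ.norm_eval_le_card (p ^ n)).trans ?_
    have hb : ‖trigPoly Sig (p ^ n)‖ ≤ ‖trigPoly Sig p‖ ^ n := by
      rw [map_pow]
      rcases Nat.eq_zero_or_pos n with rfl | hn
      · rw [pow_zero, pow_zero]
        exact (norm_one (α := (Fin k → ℝ) →ᵇ ℂ)).le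
      · exact norm_pow_le' _ hn
    refine mul_le_mul ?_ hb (norm_nonneg _) (by positivity)
    exact_mod_cast (Finset.card_le_card (support_coeff_pow_subset p n)).trans
      (card_growthBox_le _ _)
  -- For norm zero the case `n = 1` suffices; otherwise the powers of the quotient of the two norms
  -- grow at most polynomially.
  rcases (norm_nonneg (trigPoly Sig p)).eq_or_lt with h0 | h0
  · have := h 1
    rw [← h0] at this ⊢
    simpa using this
  · rw [← div_le_one h0]
    refine le_one_of_pow_le (d := p.coeff.support.card) fun n => ?_
    rw [div_pow, div_le_iff₀ (by positivity)]
    exact h n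

lemma denseRange_trigPoly : DenseRange (trigPoly Sig) := by
  intro f
  refine Metric.mem_closure_iff.2 fun ε hε => ?_
  obtain ⟨p, hp, hfp⟩ := exists_mem_span_expoAP f hε
  refine ⟨p, ?_, by rwa [dist_eq_norm]⟩
  have : Submodule.span ℂ (Set.range (expoAP Sig)) ≤ LinearMap.range (trigPoly Sig).toLinearMap := by
    refine Submodule.span_le.2 ?_
    rintro _ ⟨l, rfl⟩
    exact ⟨AddMonoidAlgebra.of ℂ Sig l, AddMonoidAlgebra.lift_of _ _⟩
  exact this hp

/-- Every semicharacter extends to a character of `AP^k_Σ`. -/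
lemma Semichar.exists_char (χ : Semichar Sig) :
    ∃ φ : APOn Sig →ₐ[ℂ] ℂ, ∀ l : Sig, φ (expoAP Sig (.ofAdd l)) = χ.1 l := by
  -- The contractive bound makes evaluation depend only on the function that the polynomial
  -- represents, and lets it extend to the closure.
  let ψ : APOn Sig →L[ℂ] ℂ := χ.eval.toLinearMap.extendOfNorm (trigPoly Sig).toLinearMap
  have hψ : ∀ p, ψ (trigPoly Sig p) = χ.eval p :=
    LinearMap.extendOfNorm_eq (e := (trigPoly Sig).toLinearMap) denseRange_trigPoly
      ⟨1, fun p => by rw [one_mul]; exact χ.norm_eval_le p⟩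
  refine ⟨AlgHom.ofLinearMap ψ ?_ ?_, fun l => ?_⟩
  · change ψ 1 = 1
    rw [← map_one (trigPoly Sig), hψ, map_one]
  · refine denseRange_trigPoly.induction_on₂ ?_ fun p q => ?_
    · exact isClosed_eq (ψ.continuous.comp continuous_mul)
        ((ψ.continuous.comp continuous_fst).mul (ψ.continuous.comp continuous_snd))
    · change ψ _ = ψ _ * ψ _
      rw [← map_mul, hψ, hψ, hψ, map_mul]
  · have h : expoAP Sig (.ofAdd l) = trigPoly Sig (AddMonoidAlgebra.of ℂ Sig (.ofAdd l)) :=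
      (AddMonoidAlgebra.lift_of _ _).symm
    change ψ _ = _
    rw [h, hψ]
    exact AddMonoidAlgebra.lift_of _ _

theorem contractibleSpace_maximalIdealSpace_APOn {S : Set (Fin k → ℝ)} (hS : IsHalfspace S)
    (hSig : (Sig : Set (Fin k → ℝ)) ⊆ S) : ContractibleSpace (MaximalIdealSpace (APOn Sig)) := by
  have := Semichar.contractibleSpace hS hSig
  obtain ⟨h⟩ := nonempty_homeomorph_semichar (fun f : APOn Sig => ‖f‖) (expoAP Sig) norm_char_le
    (fun l => (norm_expo _).le) (fun f ε hε => exists_mem_span_expoAP f hε) Semichar.exists_char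
  exact h.contractibleSpace

/-! ### The algebra `APW^k_Σ` -/

/-- The Wiener norm. -/
def wienerNorm (f : (Fin k → ℝ) →ᵇ ℂ) : ℝ := ∑' l, ‖bohrCoeff f l‖

lemma summable_norm_mul_shift {a b : (Fin k → ℝ) → ℂ} (ha : Summable fun l => ‖a l‖)
    (hb : Summable fun l => ‖b l‖) :
    Summable fun p : (Fin k → ℝ) × (Fin k → ℝ) => ‖a p.2‖ * ‖b (p.1 - p.2)‖ := by
  let sh : (Fin k → ℝ) × (Fin k → ℝ) ≃ (Fin k → ℝ) × (Fin k → ℝ) :=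
    { toFun := fun p => (p.1 - p.2, p.2)
      invFun := fun p => (p.1 + p.2, p.2)
      left_inv := fun p => by simp
      right_inv := fun p => by simp }
  have h := hb.mul_of_nonneg ha (fun _ => norm_nonneg _) (fun _ => norm_nonneg _)
  exact (sh.summable_iff.2 h).congr fun p => mul_comm _ _

/-- The coefficients of a product are a convolution; the sums of absolute values may be
interchanged. -/
lemma wienerNorm_mul_le {f g : (Fin k → ℝ) →ᵇ ℂ} (hf : f ∈ APWOn Sig) (hg : g ∈ APWOn Sig) :
    wienerNorm (f * g) ≤ wienerNorm f * wienerNorm g := by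
  have h1 := summable_norm_mul_shift hf.2.1 hg.2.1
  have h2 : ∀ l, ‖bohrCoeff (f * g : (Fin k → ℝ) →ᵇ ℂ) l‖
      ≤ ∑' m, ‖bohrCoeff f m‖ * ‖bohrCoeff g (l - m)‖ := by
    intro l
    rw [← (hasSum_bohrCoeff_mul hf.1 hg.1 l).tsum_eq]
    simp_rw [← norm_mul]
    refine norm_tsum_le_tsum_norm ?_
    simpa using h1.prod_factor l
  refine (((APWOn Sig).mul_mem hf hg).2.1.tsum_le_tsum h2 h1.prod).trans_eq ?_
  have h3 : ∀ m, ∑' l, ‖bohrCoeff f m‖ * ‖bohrCoeff g (l - m)‖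
      = ‖bohrCoeff f m‖ * wienerNorm g := fun m => by
    rw [tsum_mul_left]
    exact congrArg _ ((Equiv.subRight m).tsum_eq fun l => ‖bohrCoeff g l‖)
  calc ∑' l, ∑' m, ‖bohrCoeff f m‖ * ‖bohrCoeff g (l - m)‖
      = ∑' m, ∑' l, ‖bohrCoeff f m‖ * ‖bohrCoeff g (l - m)‖ :=
        Summable.tsum_comm (f := fun m l => ‖bohrCoeff f m‖ * ‖bohrCoeff g (l - m)‖)
          ((Equiv.prodComm _ _).summable_iff.1 h1)
    _ = ∑' m, ‖bohrCoeff f m‖ * wienerNorm g := tsum_congr h3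
    _ = wienerNorm f * wienerNorm g := tsum_mul_right

lemma wienerNorm_one : wienerNorm (1 : (Fin k → ℝ) →ᵇ ℂ) = 1 := by
  rw [wienerNorm, tsum_eq_single 0]
  · rw [← expo_zero, bohrCoeff_expo]; simp
  · intro l hl
    rw [← expo_zero, bohrCoeff_expo, if_neg hl.symm, norm_zero]

lemma wienerNorm_pow_le {f : (Fin k → ℝ) →ᵇ ℂ} (hf : f ∈ APWOn Sig) (n : ℕ) :
    wienerNorm (f ^ n) ≤ wienerNorm f ^ n := by
  induction n with
  | zero => rw [pow_zero, pow_zero, wienerNorm_one]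
  | succ n ih =>
    rw [pow_succ, pow_succ]
    refine (wienerNorm_mul_le ((APWOn Sig).pow_mem hf n) hf).trans ?_
    exact mul_le_mul_of_nonneg_right ih (tsum_nonneg fun _ => norm_nonneg _)

lemma wienerNorm_smul (c : ℂ) {f : (Fin k → ℝ) →ᵇ ℂ} (hf : f ∈ AP k) :
    wienerNorm (c • f) = ‖c‖ * wienerNorm f := by
  simp only [wienerNorm, bohrCoeff_smul c hf, norm_mul, tsum_mul_left]

lemma hasSum_bohrCoeff {ι : Type*} {F : ι → (Fin k → ℝ) →ᵇ ℂ} (hF : ∀ i, F i ∈ AP k)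
    {g : (Fin k → ℝ) →ᵇ ℂ} (h : HasSum F g) (hg : g ∈ AP k) (l : Fin k → ℝ) :
    HasSum (fun i => bohrCoeff (F i) l) (bohrCoeff g l) := by
  rw [HasSum, tendsto_iff_norm_sub_tendsto_zero] at h ⊢
  refine squeeze_zero (fun _ => norm_nonneg _) (fun s => ?_) h
  rw [← bohrCoeff_sum s F hF, ← bohrCoeff_sub (sum_mem fun i _ => hF i) hg]
  exact norm_bohrCoeff_le (sub_mem (sum_mem fun i _ => hF i) hg) l

/-- Elements of Wiener norm less than `1` are quasi-invertible in `APW^k_Σ`. -/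
lemma isUnit_one_sub_of_wienerNorm_lt_one (f : APWOn Sig)
    (h : wienerNorm (f : (Fin k → ℝ) →ᵇ ℂ) < 1) : IsUnit (1 - f) := by
  obtain ⟨f, hf⟩ := f
  change wienerNorm f < 1 at h
  have hw0 : 0 ≤ wienerNorm f := tsum_nonneg fun _ => norm_nonneg _
  -- The sup norm is dominated, so the Neumann series converges uniformly to an inverse in `AP^k`;
  -- it remains to see that the sum has finite Wiener norm and spectrum in `Σ`, and completeness of
  -- `APW^k_Σ` is not needed.
  have hf1 : ‖f‖ < 1 := (norm_le_tsum_norm_bohrCoeff hf.1 hf.2.1).trans_lt h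
  have hsum := (summable_geometric_of_norm_lt_one hf1).hasSum
  have hinv := mul_neg_geom_series f hf1
  generalize ∑' n : ℕ, f ^ n = g at hsum hinv
  have hg : g ∈ AP k := isClosed_AP.mem_of_tendsto hsum
    (Eventually.of_forall fun s => sum_mem fun n _ => pow_mem hf.1 n)
  have hcoeff := hasSum_bohrCoeff (fun n => pow_mem hf.1 n) hsum hg
  have hpow : ∀ n : ℕ, f ^ n ∈ APWOn Sig := fun n => (APWOn Sig).pow_mem hf n
  have hgeo : Summable fun n : ℕ => wienerNorm f ^ n := summable_geometric_of_lt_one hw0 h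
  have hle : ∀ l (n : ℕ), ‖bohrCoeff (f ^ n : (Fin k → ℝ) →ᵇ ℂ) l‖ ≤ wienerNorm f ^ n :=
    fun l n => ((hpow n).2.1.le_tsum l fun _ _ => norm_nonneg _).trans (wienerNorm_pow_le hf n)
  have hsn : ∀ l, Summable fun n : ℕ => ‖bohrCoeff (f ^ n : (Fin k → ℝ) →ᵇ ℂ) l‖ := fun l =>
    Summable.of_nonneg_of_le (fun _ => norm_nonneg _) (hle l) hgeo
  have hgm : g ∈ APWOn Sig := by
    refine ⟨hg, ?_, fun l hl => by_contra fun hlS => hl ?_⟩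
    · refine summable_of_sum_le (c := ∑' n : ℕ, wienerNorm f ^ n) (fun _ => norm_nonneg _)
        fun s => ?_
      calc ∑ l ∈ s, ‖bohrCoeff g l‖
          ≤ ∑ l ∈ s, ∑' n : ℕ, ‖bohrCoeff (f ^ n : (Fin k → ℝ) →ᵇ ℂ) l‖ := by
            refine Finset.sum_le_sum fun l _ => ?_
            rw [← (hcoeff l).tsum_eq]
            exact norm_tsum_le_tsum_norm (hsn l)
        _ = ∑' n : ℕ, ∑ l ∈ s, ‖bohrCoeff (f ^ n : (Fin k → ℝ) →ᵇ ℂ) l‖ :=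
            (Summable.tsum_finsetSum fun l _ => hsn l).symm
        _ ≤ _ := by
            refine (summable_sum fun l _ => hsn l).tsum_le_tsum (fun n => ?_) hgeo
            exact ((hpow n).2.1.sum_le_tsum s fun _ _ => norm_nonneg _).trans
              (wienerNorm_pow_le hf n)
    · refine (hcoeff l).unique ?_
      convert hasSum_zero with n
      exact not_not.1 fun hne => hlS ((hpow n).2.2 hne)
  refine IsUnit.of_mul_eq_one (⟨g, hgm⟩ : APWOn Sig) (Subtype.ext ?_)
  exact hinv

/-- If `|φ f|` were larger, `1 - f / φ f` would be invertible and yet be killed by `φ`. -/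
lemma norm_char_le_wienerNorm (φ : APWOn Sig →ₐ[ℂ] ℂ) (f : APWOn Sig) :
    ‖φ f‖ ≤ wienerNorm (f : (Fin k → ℝ) →ᵇ ℂ) := by
  by_contra! h
  have hw0 : 0 ≤ wienerNorm (f : (Fin k → ℝ) →ᵇ ℂ) := tsum_nonneg fun _ => norm_nonneg _
  have hc : 0 < ‖φ f‖ := hw0.trans_lt h
  have h1 : wienerNorm (((φ f)⁻¹ • f : APWOn Sig) : (Fin k → ℝ) →ᵇ ℂ) < 1 := by
    change wienerNorm ((φ f)⁻¹ • (f : (Fin k → ℝ) →ᵇ ℂ)) < 1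
    rw [wienerNorm_smul _ f.2.1, norm_inv, inv_mul_lt_iff₀ hc, mul_one]
    exact h
  have h2 := (isUnit_one_sub_of_wienerNorm_lt_one _ h1).map φ
  rw [map_sub, map_one, AlgHom.map_smul_of_tower, smul_eq_mul, inv_mul_cancel₀ (norm_pos_iff.1 hc), sub_self] at h2
  exact not_isUnit_zero h2

lemma expo_mem_APWOn (l : Sig) : expo (l : Fin k → ℝ) ∈ APWOn Sig := by
  refine ⟨expo_mem _, summable_of_ne_finset_zero (s := {(l : Fin k → ℝ)}) fun m hm => ?_,
    (expo_mem_APOn l).2⟩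
  rw [bohrCoeff_expo, if_neg (by simpa [eq_comm] using hm), norm_zero]

/-- The exponentials in `APW^k_Σ`. -/
def expoAPW (Sig : AddSubmonoid (Fin k → ℝ)) : Multiplicative Sig →* APWOn Sig where
  toFun l := ⟨expo (l.toAdd : Fin k → ℝ), expo_mem_APWOn _⟩
  map_one' := Subtype.ext expo_zero
  map_mul' _ _ := Subtype.ext (expo_add _ _)

lemma wienerNorm_expo (l : Fin k → ℝ) : wienerNorm (expo l) = 1 := by
  rw [wienerNorm, tsum_eq_single l]
  · rw [bohrCoeff_expo]; simp
  · intro m hm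
    rw [bohrCoeff_expo, if_neg hm.symm, norm_zero]

lemma exists_mem_span_expoAPW (f : APWOn Sig) {ε : ℝ} (hε : 0 < ε) :
    ∃ p ∈ Submodule.span ℂ (Set.range (expoAPW Sig)),
      wienerNorm ((f - p : APWOn Sig) : (Fin k → ℝ) →ᵇ ℂ) < ε := by
  classical
  obtain ⟨f, hf⟩ := f
  -- Truncation suffices: the Wiener norm of the error is the tail of a convergent series.
  have hlim := tendsto_tsum_compl_atTop_zero fun l => ‖bohrCoeff f l‖
  obtain ⟨F, hF⟩ := (hlim.eventually_lt_const hε).exists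
  have hmem : ∀ l : Fin k → ℝ, bohrCoeff f l • expo l ∈ APWOn Sig := fun l => by
    by_cases h : l ∈ Sig
    · exact (APWOn Sig).smul_mem (expo_mem_APWOn ⟨l, h⟩) _
    · rw [not_not.1 fun hne => h (hf.2.2 hne), zero_smul]; exact zero_mem _
  let q : APWOn Sig := ∑ l ∈ F, ⟨bohrCoeff f l • expo l, hmem l⟩
  refine ⟨q, Submodule.sum_mem _ fun l _ => ?_, lt_of_eq_of_lt ?_ hF⟩
  · by_cases h : l ∈ Sig
    · have h0 : (⟨bohrCoeff f l • expo l, hmem l⟩ : APWOn Sig)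
          = bohrCoeff f l • expoAPW Sig (.ofAdd ⟨l, h⟩) := rfl
      rw [h0]
      exact Submodule.smul_mem _ _ (Submodule.subset_span (Set.mem_range_self _))
    · have h0 : (⟨bohrCoeff f l • expo l, hmem l⟩ : APWOn Sig) = 0 :=
        by
        refine Subtype.ext ?_
        change bohrCoeff f l • expo l = 0
        rw [not_not.1 fun hne => h (hf.2.2 hne), zero_smul]
      rw [h0]
      exact zero_mem _
  · have hq : (q : (Fin k → ℝ) →ᵇ ℂ) = ∑ l ∈ F, bohrCoeff f l • expo l :=
      AddSubmonoidClass.coe_finsetSum _ _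
    have hc : ∀ m, ‖bohrCoeff (f - ∑ l ∈ F, bohrCoeff f l • expo l : (Fin k → ℝ) →ᵇ ℂ) m‖
        = Set.indicator {x | x ∉ F} (fun l => ‖bohrCoeff f l‖) m := by
      intro m
      rw [bohrCoeff_sub hf.1 (sum_mem fun l _ => (hmem l).1),
        bohrCoeff_sum _ _ fun l => (hmem l).1]
      simp_rw [bohrCoeff_smul _ (expo_mem _), bohrCoeff_expo]
      by_cases h : m ∈ F <;> simp [h]
    change wienerNorm (f - (q : (Fin k → ℝ) →ᵇ ℂ)) = _
    rw [hq, wienerNorm, tsum_congr hc]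
    exact (tsum_subtype {x | x ∉ F} fun l => ‖bohrCoeff f l‖).symm

lemma APWOn_le_APOn : APWOn Sig ≤ APOn Sig := fun _ hf => ⟨hf.1, hf.2.2⟩

theorem contractibleSpace_maximalIdealSpace_APWOn {S : Set (Fin k → ℝ)} (hS : IsHalfspace S)
    (hSig : (Sig : Set (Fin k → ℝ)) ⊆ S) : ContractibleSpace (MaximalIdealSpace (APWOn Sig)) := by
  have := Semichar.contractibleSpace hS hSig
  obtain ⟨h⟩ := nonempty_homeomorph_semichar
    (fun f : APWOn Sig => wienerNorm (f : (Fin k → ℝ) →ᵇ ℂ)) (expoAPW Sig)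
    norm_char_le_wienerNorm (fun l => (wienerNorm_expo _).le)
    (fun f ε hε => exists_mem_span_expoAPW f hε) fun χ => by
      -- The character of the larger algebra `AP^k_Σ` restricts to `APW^k_Σ`.
      obtain ⟨φ, hφ⟩ := χ.exists_char
      exact ⟨φ.comp (Subalgebra.inclusion APWOn_le_APOn), hφ⟩
  exact h.contractibleSpace

end AlmostPeriodic

end

theorem theorem3p1 (k : ℕ) (S : Set (Fin k → ℝ)) (hS : AlmostPeriodic.IsHalfspace S)
    (Sig : AddSubmonoid (Fin k → ℝ)) (hSig : (Sig : Set (Fin k → ℝ)) ⊆ S) :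
    ContractibleSpace (AlmostPeriodic.MaximalIdealSpace (AlmostPeriodic.APOn Sig)) ∧
      ContractibleSpace (AlmostPeriodic.MaximalIdealSpace (AlmostPeriodic.APWOn Sig)) :=
  ⟨AlmostPeriodic.contractibleSpace_maximalIdealSpace_APOn hS hSig,
    AlmostPeriodic.contractibleSpace_maximalIdealSpace_APWOn hS hSig⟩
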